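/- Let $X=(X_t)_{t\ge 0}$ be a real-valued Lévy process with $X_0=0$ on a probability space $(\Omega,\mathcal F,P)$ such that $E(e^{2X_1})<\infty$, $E(|X_1|^n)<\infty$ for $n\in\{1,\dots,5\}$ and $\operatorname{Var}(X_1)>0$. Put $\mu:=E(X_1)$, $\sigma:=\sqrt{\operatorname{Var}(X_1)}$ and $D:=\{y\in\mathbb C: E(e^{\operatorname{Re}(y)X_1})<\infty\}$, and let $R\in\mathbb R\setminus\{0\}$ satisfy $2R\in\operatorname{int}D$. Define $$X^\lambda_t:=\Bigl(1-\frac1\lambda\Bigr)\mu t+\lambda X_{t/\lambda^2}\quad(\lambda\in(0,1]),\qquad X^0_t:=\mu t+\sigma W_t,\qquad t\ge 0,$$ where $W$ is a standard Brownian motion (possibly on another probability space). For $\lambda\in[0,1]$ let $D^\lambda:=\{y\in\mathbb C: E(e^{\operatorname{Re}(y)X^\lambda_1})<\infty\}$ and let $\kappa^\lambda:D^\lambda\to\mathbb C$ be the cumulant generating function of $X^\lambda$, that is, the unique continuous function with $E(e^{zX^\lambda_t})=e^{t\kappa^\lambda(z)}$ for all $t\ge 0$ and $z\in D^\lambda$.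 Then, for every $\lambda\in[0,1]$, the function $\kappa^\lambda$ exists and $\{0,R,2R\}+i\mathbb R\subset D^\lambda$. The mapping $\kappa:[0,1]\times(\{0,R,2R\}+i\mathbb R)\to\mathbb C$, $(\lambda,z)\mapsto\kappa^\lambda(z)$, is twice partially differentiable with respect to $\lambda$ (one-sidedly at $\lambda=0$ and $\lambda=1$), and $\kappa$, $\frac{\partial}{\partial\lambda}\kappa$, $\frac{\partial^2}{\partial\lambda^2}\kappa$ are continuous on $[0,1]\times(\{0,R,2R\}+i\mathbb R)$. For all $z\in\{0,R,2R\}+i\mathbb R$, \begin{align*} \kappa^0(z)&=\mu z+\tfrac12\sigma^2z^2,\\ \frac{\partial}{\partial\lambda}\kappa^\lambda(z)\Big|_{\lambda=0}&=\tfrac16E\bigl((X_1-\mu)^3\bigr)z^3,\\ \frac{\partial^2}{\partial\lambda^2}\kappa^\lambda(z)\Big|_{\lambda=0}&=\tfrac1{12}\bigl(E\bigl((X_1-\mu)^4\bigr)-3\sigma^4\bigr)z^4. \end{align*} Moreover, there is a constant $c_1>0$, not depending on $\lambda$, $z$, $n$, such that $$\Bigl|\frac{\partial^n}{\partial\lambda^n}\kappa^\lambda(z)\Bigr|\le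 c_1\bigl(1+|z|^{3+n}\bigr)\quad\text{for all }(\lambda,z)\in[0,1]\times(\{0,R,2R\}+i\mathbb R),\ n\in\{0,1,2\}.$$ -/

import Mathlib

open MeasureTheory ProbabilityTheory Filter Topology Set
open scoped NNReal

noncomputable section

/-- A real-valued Lévy process (started at `0`), indexed by `ℝ≥0`, on `(Ω, P)`. -/
structure IsLevyProcess {Ω : Type*} [MeasurableSpace Ω] (X : ℝ≥0 → Ω → ℝ) (P : Measure Ω) :
    Prop where
  measurable : ∀ t, Measurable (X t)
  zero : ∀ᵐ ω ∂P, X 0 ω = 0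
  indep_increments : HasIndepIncrements X P
  stationary_increments : ∀ s t : ℝ≥0,
    IdentDistrib (fun ω ↦ X (s + t) ω - X s ω) (fun ω ↦ X t ω - X 0 ω) P P
  stochastically_continuous : ∀ t : ℝ≥0, TendstoInMeasure P X (𝓝 t) (X t)
  cadlag : ∀ᵐ ω ∂P, ∀ t : ℝ≥0,
    ContinuousWithinAt (fun s ↦ X s ω) (Ici t) t ∧
      ∃ l : ℝ, Tendsto (fun s ↦ X s ω) (𝓝[<] t) (𝓝 l)

/-- `{y ∈ ℂ | E[exp (Re y · Y₁)] < ∞}`. -/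
def expDomain {Ω : Type*} [MeasurableSpace Ω] (Y : ℝ≥0 → Ω → ℝ) (P : Measure Ω) : Set ℂ :=
  {y | Integrable (fun ω ↦ Real.exp (y.re * Y 1 ω)) P}

/-- `κ` is a cumulant generating function of `Y`: it is continuous on the domain of `Y`, and
`E[exp (z Y_t)] = exp (t κ(z))` for all `t ≥ 0` and all `z` in the domain. -/
def IsCumulantGenFun {Ω : Type*} [MeasurableSpace Ω] (Y : ℝ≥0 → Ω → ℝ) (P : Measure Ω)
    (κ : ℂ → ℂ) : Prop :=
  ContinuousOn κ (expDomain Y P) ∧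
    ∀ t : ℝ≥0, ∀ z ∈ expDomain Y P,
      ∫ ω, Complex.exp (z * (Y t ω : ℂ)) ∂P = Complex.exp ((t : ℂ) * κ z)

open Classical in
/-- The cumulant generating function of `Y`, if there is one (it is then unique on the domain of
`Y`, see `IsCumulantGenFun.eqOn`), and `0` otherwise. -/
def cumulantGenFun {Ω : Type*} [MeasurableSpace Ω] (Y : ℝ≥0 → Ω → ℝ) (P : Measure Ω) : ℂ → ℂ :=
  if h : ∃ κ, IsCumulantGenFun Y P κ then h.choose else 0

theorem IsCumulantGenFun.eqOn {Ω : Type*} [MeasurableSpace Ω] {Y : ℝ≥0 → Ω → ℝ} {P : Measure Ω}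
    {κ κ' : ℂ → ℂ} (h : IsCumulantGenFun Y P κ) (h' : IsCumulantGenFun Y P κ') :
    EqOn κ κ' (expDomain Y P) := by
  intro z hz
  have key : ∀ t : ℝ≥0, Complex.exp ((t : ℂ) * κ z) = Complex.exp ((t : ℂ) * κ' z) := fun t ↦ by
    rw [← h.2 t z hz, ← h'.2 t z hz]
  have hd : ∀ w : ℂ, HasDerivWithinAt (fun t : ℝ ↦ Complex.exp ((t : ℂ) * w)) w (Ici 0) 0 := by
    intro w
    have h1 : HasDerivAt (fun t : ℝ ↦ (t : ℂ) * w) (1 * w) 0 :=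
      (Complex.ofRealCLM.hasDerivAt (x := (0 : ℝ))).mul_const w
    simpa using h1.cexp.hasDerivWithinAt (s := Ici 0)
  refine (uniqueDiffOn_Ici (0 : ℝ) 0 self_mem_Ici).eq_deriv _ (hd (κ z)) ?_
  refine (hd (κ' z)).congr (fun t ht ↦ ?_) ?_
  · exact key ⟨t, ht⟩
  · simp

/-- `X^l_t = (1 - 1/l) μ t + l X_{t/l²}` with `μ = E[X₁]`, for `l ∈ (0, 1]`. -/
def scaledProcess {Ω : Type*} [MeasurableSpace Ω] (X : ℝ≥0 → Ω → ℝ) (P : Measure Ω) (l : ℝ) :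
    ℝ≥0 → Ω → ℝ :=
  fun t ω ↦ (1 - 1 / l) * (∫ ω', X 1 ω' ∂P) * (t : ℝ) + l * X (t / l.toNNReal ^ 2) ω

/-- Brownian motion with drift, `μ t + σ W_t`. -/
def driftedProcess {Ω' : Type*} (μ σ : ℝ) (W : ℝ≥0 → Ω' → ℝ) : ℝ≥0 → Ω' → ℝ :=
  fun t ω ↦ μ * (t : ℝ) + σ * W t ω

/-- The family `κ^l`, `l ∈ [0, 1]`, of cumulant generating functions of the curve of Lévy processes
that joins `X^0 = μ t + σ W_t` (on a space of its own), where `μ = E[X₁]`, `σ = √Var[X₁]`,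
to `X^1 = X`. -/
def kappaFamily {Ω Ω' : Type*} [MeasurableSpace Ω] [MeasurableSpace Ω']
    (X : ℝ≥0 → Ω → ℝ) (P : Measure Ω) (W : ℝ≥0 → Ω' → ℝ) (P' : Measure Ω') (l : ℝ) : ℂ → ℂ :=
  if l = 0 then cumulantGenFun (driftedProcess (∫ ω, X 1 ω ∂P) √(variance (X 1) P) W) P'
  else cumulantGenFun (scaledProcess X P l) P

/-- The three vertical lines `{0, R, 2R} + iℝ` in `ℂ`. -/
def verticalLines (R : ℝ) : Set ℂ :=
  {z | z.re ∈ ({0, R, 2 * R} : Set ℝ)}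

end

/-
The cumulants of a Lévy process scale: `κ^λ(z) = (1 - 1/λ) μ z + λ⁻² k(λ z)` for the cumulant
generating function `k` of `X`. Since `k(0) = 0` and the first derivative of `k` at `0` is `μ`,
Taylor's formula turns this into `κ^λ(z) = μ z + z² ∫₀¹ (1 - t) (D²k)(t λ z) dt`, which makes sense
at `λ = 0` and can be differentiated there. Everything then follows from boundedness of `Dⁿk`,
`2 ≤ n ≤ 4`, on the strip between `0` and `2R`, and there infinite divisibility enters: `Dⁿk(z)` is
the limit of `t⁻¹ E[X_t ^ n e ^ (z X_t)]` as `t → 0`, and for `2 ≤ n ≤ 4` the norm of this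
expectation is at most the sum of the nonnegative expectations for `n = 2` and `n = 4` at the real
point `Re z`, which stays in a compact interval.
-/

theorem eq_zero_of_map_eq_zero_of_forall_le {f : ℝ≥0 →+ ℝ} {δ : ℝ≥0} (hδ : 0 < δ) (hfδ : f δ = 0)
    {c : ℝ} (hc : ∀ t ≤ δ, c ≤ f t) : f = 0 := by
  have h_periodic : ∀ (n : ℕ) t, f (n • δ + t) = f t := fun n t ↦ by
    rw [map_add, map_nsmul, hfδ, smul_zero, zero_add]
  have h_le : ∀ t, c ≤ f t := fun t ↦ by
    have h_floor : ⌊t / δ⌋₊ • δ ≤ t := by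
      rw [nsmul_eq_mul, ← le_div_iff₀ hδ]
      exact Nat.floor_le zero_le
    have h_rest : t - ⌊t / δ⌋₊ • δ ≤ δ := by
      rw [tsub_le_iff_left, nsmul_eq_mul, ← add_one_mul, ← div_le_iff₀ hδ]
      exact (Nat.lt_floor_add_one _).le
    rw [← add_tsub_cancel_of_le h_floor, h_periodic]
    exact hc _ h_rest
  have h_nonneg : ∀ t, 0 ≤ f t := fun t ↦ by
    by_contra! ht
    obtain ⟨n, hn⟩ := Archimedean.arch (-c + 1) (neg_pos.2 ht)
    have := h_le (n • t)
    rw [map_nsmul] at this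
    simp only [smul_neg] at hn
    linarith
  ext t
  obtain ⟨n, hn⟩ := Archimedean.arch t hδ
  have h_sum : f t + f (n • δ - t) = 0 := by
    rw [← map_add, add_tsub_cancel_of_le hn, map_nsmul, hfδ, smul_zero]
  have h_rest := h_nonneg (n • δ - t)
  exact le_antisymm (by rw [AddMonoidHom.zero_apply]; linarith) (h_nonneg t)

theorem addMonoidHom_eq_mul_of_forall_le (f : ℝ≥0 →+ ℝ) {δ : ℝ≥0} (hδ : 0 < δ) {c : ℝ}
    (hc : ∀ t ≤ δ, c ≤ f t) (t : ℝ≥0) : f t = t * (f δ / δ) := by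
  have hδ' : (δ : ℝ) ≠ 0 := by exact_mod_cast hδ.ne'
  let g : ℝ≥0 →+ ℝ :=
    f - (AddMonoidHom.mulRight (f δ / δ)).comp NNReal.toRealHom.toAddMonoidHom
  have hg_apply : ∀ t, g t = f t - t * (f δ / δ) := fun _ ↦ rfl
  have hg_zero : g = 0 := by
    refine eq_zero_of_map_eq_zero_of_forall_le (c := c - |f δ|) hδ ?_ fun t ht ↦ ?_
    · rw [hg_apply, mul_div_cancel₀ _ hδ', sub_self]
    · have ht' : (t : ℝ) / δ ≤ 1 := div_le_one_of_le₀ ht δ.2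
      have h_lin : t * (f δ / δ) ≤ |f δ| := calc
        t * (f δ / δ) = t / δ * f δ := by ring
        _ ≤ t / δ * |f δ| := by gcongr; exact le_abs_self _
        _ ≤ |f δ| := mul_le_of_le_one_left (abs_nonneg _) ht'
      rw [hg_apply]
      linarith [hc t ht]
  exact sub_eq_zero.1 ((hg_apply t).symm.trans (DFunLike.congr_fun hg_zero t))

theorem continuous_of_map_add_eq_mul_of_forall_le {f : ℝ≥0 → ℝ} (hpos : ∀ t, 0 < f t)
    (hmul : ∀ s t, f (s + t) = f s * f t) {δ : ℝ≥0} (hδ : 0 < δ) {c : ℝ} (hc : 0 < c)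
    (hle : ∀ t ≤ δ, c ≤ f t) : Continuous f := by
  have hadd : ∀ s t, Real.log (f (s + t)) = Real.log (f s) + Real.log (f t) := fun s t ↦ by
    rw [hmul, Real.log_mul (hpos s).ne' (hpos t).ne']
  let logf : ℝ≥0 →+ ℝ :=
    { toFun := fun t ↦ Real.log (f t)
      map_zero' := by simpa using hadd 0 0
      map_add' := hadd }
  have hf : f = fun t : ℝ≥0 ↦ Real.exp (t * (logf δ / δ)) := by
    ext t
    rw [← addMonoidHom_eq_mul_of_forall_le logf hδ (fun s hs ↦ Real.log_le_log hc (hle s hs)) t]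
    exact (Real.exp_log (hpos t)).symm
  rw [hf]
  fun_prop

section ContinuousMultiplicative

variable {f : ℝ≥0 → ℂ} {δ : ℝ≥0}

theorem exists_integral_ne_zero_of_continuous (hf : Continuous f) (h0 : f 0 ≠ 0) :
    ∃ δ : ℝ≥0, ∫ s in (0 : ℝ)..δ, f s.toNNReal ≠ 0 := by
  have hf' : Continuous fun s : ℝ ↦ f s.toNNReal := hf.comp continuous_real_toNNReal
  have hderiv : HasDerivAt (fun u ↦ ∫ r in (0 : ℝ)..u, f r.toNNReal) (f (0 : ℝ).toNNReal) 0 :=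
    hf'.integral_hasStrictDerivAt 0 0 |>.hasDerivAt
  have hne : ∀ᶠ u : ℝ in 𝓝[>] 0, ∫ r in (0 : ℝ)..u, f r.toNNReal ≠ 0 :=
    (hderiv.eventually_ne (c := 0) (by simpa using h0)).filter_mono
      (nhdsWithin_mono _ fun _ hx ↦ ne_of_gt hx)
  obtain ⟨u, hu, hu0⟩ := (hne.and self_mem_nhdsWithin).exists
  exact ⟨⟨u, le_of_lt hu0⟩, hu⟩

theorem mul_integral_eq_of_map_add_eq_mul (hmul : ∀ s t, f (s + t) = f s * f t) {s : ℝ}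
    (hs : 0 ≤ s) :
    f s.toNNReal * ∫ r in (0 : ℝ)..δ, f r.toNNReal = ∫ r in s..(s + δ), f r.toNNReal := by
  have hshift : ∫ r in s..(s + δ), f r.toNNReal = ∫ r in (0 : ℝ)..δ, f (s + r).toNNReal := by
    rw [intervalIntegral.integral_comp_add_left (fun r ↦ f r.toNNReal) s, add_zero]
  rw [hshift, ← intervalIntegral.integral_const_mul]
  refine intervalIntegral.integral_congr fun r hr ↦ ?_
  rw [uIcc_of_le δ.coe_nonneg] at hr
  simp only [Real.toNNReal_add hs hr.1, hmul]

theorem hasDerivWithinAt_of_map_add_eq_mul (hf : Continuous f)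
    (hmul : ∀ s t, f (s + t) = f s * f t) (hδ : ∫ s in (0 : ℝ)..δ, f s.toNNReal ≠ 0) {s : ℝ}
    (hs : 0 ≤ s) :
    HasDerivWithinAt (fun u : ℝ ↦ f u.toNNReal)
      (f s.toNNReal * ((f δ - 1) / ∫ r in (0 : ℝ)..δ, f r.toNNReal)) (Ici s) s := by
  set I := ∫ r in (0 : ℝ)..δ, f r.toNNReal
  have hf' : Continuous fun s : ℝ ↦ f s.toNNReal := hf.comp continuous_real_toNNReal
  have hF : ∀ x : ℝ, HasDerivAt (fun u ↦ ∫ r in (0 : ℝ)..u, f r.toNNReal) (f x.toNNReal) x :=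
    fun x ↦ (hf'.integral_hasStrictDerivAt 0 x).hasDerivAt
  have hmean : ∀ u ∈ Ici s, f u.toNNReal =
      ((∫ r in (0 : ℝ)..(u + δ), f r.toNNReal) - ∫ r in (0 : ℝ)..u, f r.toNNReal) / I := by
    intro u hu
    rw [intervalIntegral.integral_interval_sub_left (hf'.intervalIntegrable _ _)
      (hf'.intervalIntegrable _ _), ← mul_integral_eq_of_map_add_eq_mul hmul (hs.trans hu),
      mul_div_cancel_right₀ _ hδ]
  have hderiv := (((hF (s + δ)).comp_add_const s δ).sub (hF s)).div_const I
  refine (hderiv.hasDerivWithinAt.congr hmean (hmean s self_mem_Ici)).congr_deriv ?_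
  rw [Real.toNNReal_add hs δ.coe_nonneg, hmul, Real.toNNReal_coe]
  ring

theorem eq_cexp_of_continuous_of_map_add_eq_mul (hf : Continuous f) (h0 : f 0 = 1)
    (hmul : ∀ s t, f (s + t) = f s * f t) (hδ : ∫ s in (0 : ℝ)..δ, f s.toNNReal ≠ 0) (t : ℝ≥0) :
    f t = Complex.exp (t * ((f δ - 1) / ∫ s in (0 : ℝ)..δ, f s.toNNReal)) := by
  set k := (f δ - 1) / ∫ s in (0 : ℝ)..δ, f s.toNNReal
  have hexp : ∀ s : ℝ, HasDerivAt (fun u : ℝ ↦ Complex.exp (-(u * k)))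
      (Complex.exp (-(s * k)) * (-(1 * k))) s := fun s ↦
    ((Complex.ofRealCLM.hasDerivAt (x := s)).mul_const k).neg.cexp
  have hcont : Continuous fun u : ℝ ↦ f u.toNNReal * Complex.exp (-(u * k)) :=
    (hf.comp continuous_real_toNNReal).mul (by fun_prop)
  have hconst : f (t : ℝ).toNNReal * Complex.exp (-((t : ℝ) * k)) =
      f (0 : ℝ).toNNReal * Complex.exp (-((0 : ℝ) * k)) :=
    constant_of_has_deriv_right_zero hcont.continuousOn (fun s hs ↦
      ((hasDerivWithinAt_of_map_add_eq_mul hf hmul hδ hs.1).mul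
        (hexp s).hasDerivWithinAt).congr_deriv (by ring)) t ⟨t.coe_nonneg, le_rfl⟩
  simp only [Real.toNNReal_coe, Real.toNNReal_zero, h0, Complex.ofReal_zero, zero_mul, neg_zero,
    Complex.exp_zero, mul_one, Complex.exp_neg] at hconst
  exact (mul_inv_eq_one₀ (Complex.exp_ne_zero _)).1 hconst

end ContinuousMultiplicative

theorem eq_of_forall_cexp_mul_eq {k k' : ℂ}
    (h : ∀ t : ℝ≥0, Complex.exp (t * k) = Complex.exp (t * k')) : k = k' := by
  have hrate : ∀ k : ℂ, HasDerivWithinAt (fun t : ℝ ↦ Complex.exp (t * k)) k (Ici 0) 0 := fun k ↦ by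
    have hlin : HasDerivAt (fun t : ℝ ↦ (t : ℂ) * k) (1 * k) 0 :=
      (Complex.ofRealCLM.hasDerivAt (x := (0 : ℝ))).mul_const k
    simpa using hlin.cexp.hasDerivWithinAt (s := Ici 0)
  exact (uniqueDiffOn_Ici (0 : ℝ) 0 self_mem_Ici).eq_deriv _ (hrate k)
    ((hrate k').congr (fun t ht ↦ h ⟨t, ht⟩) (by simp))

theorem tendsto_integral_mul_of_tendstoInMeasure {Ω ι E 𝕜 : Type*} [MeasurableSpace Ω] [RCLike 𝕜]
    [PseudoEMetricSpace E] [MeasurableSpace E] [OpensMeasurableSpace E] {P : Measure Ω}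
    {l : Filter ι} [l.IsCountablyGenerated] {X : ι → Ω → E} {Y : Ω → E}
    (hX : ∀ i, AEMeasurable (X i) P) (hXY : TendstoInMeasure P X l Y) {g : Ω → 𝕜}
    (hg : Integrable g P) {φ : E → 𝕜} (hφ : Continuous φ) {C : ℝ} (hC : ∀ x, ‖φ x‖ ≤ C) :
    Tendsto (fun i ↦ ∫ ω, g ω * φ (X i ω) ∂P) l (𝓝 (∫ ω, g ω * φ (Y ω) ∂P)) := by
  refine tendsto_of_seq_tendsto fun u hu ↦ tendsto_of_subseq_tendsto fun ns hns ↦ ?_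
  obtain ⟨ms, -, hms⟩ := (hXY.comp (hu.comp hns)).exists_seq_tendsto_ae
  refine ⟨ms, tendsto_integral_of_dominated_convergence (fun ω ↦ ‖g ω‖ * C) (fun n ↦ ?_)
    (hg.norm.mul_const C) (fun n ↦ ae_of_all _ fun ω ↦ ?_) ?_⟩
  · exact hg.1.mul (hφ.measurable.comp_aemeasurable (hX _)).aestronglyMeasurable
  · rw [norm_mul]
    gcongr
    exact hC _
  · filter_upwards [hms] with ω hω
    exact ((hφ.tendsto _).comp hω).const_mul _

/-- The weight `(1 + |x|) ^ n (1 + e ^ (a x))`. It dominates `x ^ k e ^ (z x)` for all `k ≤ n` and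
all `z` with real part between `0` and `a`, and it is submultiplicative, so that its integrability
passes from one value of a Lévy process to all the others. -/
noncomputable def polyExpWeight (n : ℕ) (a x : ℝ) : ℝ :=
  (1 + |x|) ^ n * (1 + Real.exp (a * x))

theorem polyExpWeight_pos (n : ℕ) (a x : ℝ) : 0 < polyExpWeight n a x := by
  unfold polyExpWeight
  positivity

@[fun_prop]
theorem continuous_polyExpWeight (n : ℕ) (a : ℝ) : Continuous (polyExpWeight n a) := by
  unfold polyExpWeight
  fun_prop

theorem polyExpWeight_add_le (n : ℕ) (a x y : ℝ) :
    polyExpWeight n a (x + y) ≤ polyExpWeight n a x * polyExpWeight n a y := by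
  have h_abs : 1 + |x + y| ≤ (1 + |x|) * (1 + |y|) := by
    nlinarith [abs_add_le x y, mul_nonneg (abs_nonneg x) (abs_nonneg y)]
  have h_exp : 1 + Real.exp (a * (x + y)) ≤ (1 + Real.exp (a * x)) * (1 + Real.exp (a * y)) := by
    rw [mul_add, Real.exp_add]
    nlinarith [Real.exp_pos (a * x), Real.exp_pos (a * y)]
  calc polyExpWeight n a (x + y)
      ≤ ((1 + |x|) * (1 + |y|)) ^ n * ((1 + Real.exp (a * x)) * (1 + Real.exp (a * y))) := by
        unfold polyExpWeight
        gcongr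
    _ = polyExpWeight n a x * polyExpWeight n a y := by
        rw [mul_pow]
        unfold polyExpWeight
        ring

theorem exp_mul_le_add_of_mem_Icc {a b u : ℝ} (hu : u ∈ Icc a b) (x : ℝ) :
    Real.exp (u * x) ≤ Real.exp (a * x) + Real.exp (b * x) := by
  rcases le_total 0 x with h | h
  · have := Real.exp_le_exp.2 (mul_le_mul_of_nonneg_right hu.2 h)
    linarith [Real.exp_pos (a * x)]
  · have := Real.exp_le_exp.2 (mul_le_mul_of_nonpos_right hu.1 h)
    linarith [Real.exp_pos (b * x)]

theorem exp_mul_le_one_add_of_mem_uIcc {a u : ℝ} (hu : u ∈ uIcc 0 a) (x : ℝ) :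
    Real.exp (u * x) ≤ 1 + Real.exp (a * x) := by
  rcases mem_uIcc.1 hu with h | h
  · simpa using exp_mul_le_add_of_mem_Icc h x
  · simpa [add_comm] using exp_mul_le_add_of_mem_Icc h x

theorem abs_pow_mul_exp_le_polyExpWeight {k n : ℕ} (hkn : k ≤ n) {a u : ℝ} (hu : u ∈ uIcc 0 a)
    (x : ℝ) : |x| ^ k * Real.exp (u * x) ≤ polyExpWeight n a x := by
  have h_pow : |x| ^ k ≤ (1 + |x|) ^ n := calc
    |x| ^ k ≤ (1 + |x|) ^ k := by gcongr; linarith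
    _ ≤ (1 + |x|) ^ n := pow_le_pow_right₀ (by linarith [abs_nonneg x]) hkn
  exact mul_le_mul h_pow (exp_mul_le_one_add_of_mem_uIcc hu x) (Real.exp_pos _).le (by positivity)

theorem integrable_polyExpWeight_comp {Ω : Type*} [MeasurableSpace Ω] {P : Measure Ω}
    [IsFiniteMeasure P] {Y : Ω → ℝ} (hY : AEMeasurable Y P) {n : ℕ} {a : ℝ}
    (h_pow : Integrable (fun ω ↦ |Y ω| ^ n) P)
    (h_exp : Integrable (fun ω ↦ |Y ω| ^ n * Real.exp (a * Y ω)) P) :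
    Integrable (fun ω ↦ polyExpWeight n a (Y ω)) P := by
  have h_le : ∀ x : ℝ, polyExpWeight n a x ≤
      2 ^ n * (1 + Real.exp |a| + |x| ^ n + |x| ^ n * Real.exp (a * x)) := fun x ↦ by
    rcases le_total |x| 1 with hx | hx
    · have h_exp_le : Real.exp (a * x) ≤ Real.exp |a| := Real.exp_le_exp.2 <| calc
        a * x ≤ |a| * |x| := (le_abs_self _).trans (abs_mul a x).le
        _ ≤ |a| := mul_le_of_le_one_right (abs_nonneg a) hx
      calc polyExpWeight n a x ≤ 2 ^ n * (1 + Real.exp |a|) := by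
            unfold polyExpWeight
            gcongr
            linarith
        _ ≤ _ := by
            rw [add_assoc]
            exact mul_le_mul_of_nonneg_left (le_add_of_nonneg_right (by positivity)) (by positivity)
    · calc polyExpWeight n a x ≤ (2 * |x|) ^ n * (1 + Real.exp (a * x)) := by
            unfold polyExpWeight
            gcongr
            linarith
        _ = 2 ^ n * (|x| ^ n + |x| ^ n * Real.exp (a * x)) := by ring
        _ ≤ _ := by
            gcongr
            linarith [Real.exp_pos |a|]
  refine Integrable.mono' ((((integrable_const (1 + Real.exp |a|)).add h_pow).add h_exp).const_mul
    (2 ^ n)) ((continuous_polyExpWeight n a).measurable.comp_aemeasurable hY).aestronglyMeasurable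
    (ae_of_all _ fun ω ↦ ?_)
  rw [Real.norm_of_nonneg (polyExpWeight_pos _ _ _).le]
  exact h_le (Y ω)

namespace IsLevyProcess

variable {Ω : Type*} [MeasurableSpace Ω] {P : Measure Ω} {X : ℝ≥0 → Ω → ℝ}

theorem identDistrib_sub (hX : IsLevyProcess X P) (s t : ℝ≥0) :
    IdentDistrib (X (s + t) - X s) (X t) P P := by
  refine (hX.stationary_increments s t).trans (IdentDistrib.of_ae_eq
    ((hX.measurable t).sub (hX.measurable 0)).aemeasurable ?_)
  filter_upwards [hX.zero] with ω hω
  simp [hω]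

theorem indepFun_sub (hX : IsLevyProcess X P) (s t : ℝ≥0) :
    IndepFun (X s) (X (s + t) - X s) P :=
  hX.indep_increments.indepFun_eval_sub zero_le le_self_add hX.zero

section Submultiplicative

variable {g : ℝ → ℝ}

theorem integrable_comp_add (hX : IsLevyProcess X P) (hg : Measurable g) (hpos : ∀ x, 0 < g x)
    (hmul : ∀ x y, g (x + y) ≤ g x * g y) {s t : ℝ≥0}
    (hs : Integrable (fun ω ↦ g (X s ω)) P) (ht : Integrable (fun ω ↦ g (X t ω)) P) :
    Integrable (fun ω ↦ g (X (s + t) ω)) P := by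
  have h_increment : Integrable (g ∘ (X (s + t) - X s)) P :=
    ((hX.identDistrib_sub s t).comp hg).integrable_iff.2 ht
  refine (((hX.indepFun_sub s t).comp hg hg).integrable_mul hs h_increment).mono'
    (hg.comp (hX.measurable _)).aestronglyMeasurable (ae_of_all _ fun ω ↦ ?_)
  rw [Real.norm_of_nonneg (hpos _).le]
  simpa using hmul (X s ω) (X (s + t) ω - X s ω)

variable [IsProbabilityMeasure P]

theorem integrable_comp_of_le (hX : IsLevyProcess X P) (hg : Measurable g) (hpos : ∀ x, 0 < g x)
    (hmul : ∀ x y, g (x + y) ≤ g x * g y) {s t : ℝ≥0} (hst : s ≤ t)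
    (ht : Integrable (fun ω ↦ g (X t ω)) P) : Integrable (fun ω ↦ g (X s ω)) P := by
  obtain ⟨r, rfl⟩ := le_iff_exists_add.1 hst
  have hinv : Measurable fun x ↦ (g (-x))⁻¹ := (hg.comp measurable_neg).inv
  have h_increment : Measurable (X (s + r) - X s) := (hX.measurable _).sub (hX.measurable _)
  refine ((hX.indepFun_sub s r).comp hg hinv).integrable_left_of_integrable_op
    (fun x y ↦ x * y) 1 one_ne_zero (fun x y ↦ by simp) ?_
    (hg.comp (hX.measurable s)).aestronglyMeasurable
    (hinv.comp h_increment).aestronglyMeasurable fun h ↦ ?_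
  · refine ht.mono' ((hg.comp (hX.measurable s)).mul
      (hinv.comp h_increment)).aestronglyMeasurable (ae_of_all _ fun ω ↦ ?_)
    simp only [Function.comp_apply, Pi.sub_apply]
    rw [Real.norm_of_nonneg (mul_pos (hpos _) (inv_pos.2 (hpos _))).le,
      mul_inv_le_iff₀ (hpos _)]
    simpa using hmul (X (s + r) ω) (-(X (s + r) ω - X s ω))
  · obtain ⟨ω, hω⟩ := h.exists
    exact (inv_pos.2 (hpos _)).ne' hω

theorem integrable_comp_of_one (hX : IsLevyProcess X P) (hg : Measurable g) (hpos : ∀ x, 0 < g x)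
    (hmul : ∀ x y, g (x + y) ≤ g x * g y) (h1 : Integrable (fun ω ↦ g (X 1 ω)) P) (t : ℝ≥0) :
    Integrable (fun ω ↦ g (X t ω)) P := by
  obtain ⟨n, hn⟩ := exists_nat_ge t
  refine hX.integrable_comp_of_le hg hpos hmul hn ?_
  clear hn
  induction n with
  | zero =>
    refine (integrable_const (g 0)).congr ?_
    filter_upwards [hX.zero] with ω hω
    simp [hω]
  | succ n ih =>
    push_cast
    exact hX.integrable_comp_add hg hpos hmul ih h1

end Submultiplicative

section ExponentialMoments

variable [IsProbabilityMeasure P]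

theorem integrable_exp_mul (hX : IsLevyProcess X P) {u : ℝ} (hu : u ∈ integrableExpSet (X 1) P)
    (t : ℝ≥0) : Integrable (fun ω ↦ Real.exp (u * X t ω)) P :=
  hX.integrable_comp_of_one (g := fun x ↦ Real.exp (u * x)) (by fun_prop)
    (fun _ ↦ Real.exp_pos _) (fun x y ↦ by rw [mul_add, Real.exp_add]) hu t

theorem integrableExpSet_eq (hX : IsLevyProcess X P) {t : ℝ≥0} (ht : 1 ≤ t) :
    integrableExpSet (X t) P = integrableExpSet (X 1) P :=
  Subset.antisymm (fun u hu ↦ hX.integrable_comp_of_le (g := fun x ↦ Real.exp (u * x))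
    (by fun_prop) (fun _ ↦ Real.exp_pos _) (fun x y ↦ by rw [mul_add, Real.exp_add]) ht hu)
    fun _ hu ↦ hX.integrable_exp_mul hu t

theorem integrable_polyExpWeight (hX : IsLevyProcess X P) {n : ℕ} {a : ℝ}
    (h1 : Integrable (fun ω ↦ polyExpWeight n a (X 1 ω)) P) (t : ℝ≥0) :
    Integrable (fun ω ↦ polyExpWeight n a (X t ω)) P :=
  hX.integrable_comp_of_one (by fun_prop) (polyExpWeight_pos n a) (polyExpWeight_add_le n a) h1 t

end ExponentialMoments

theorem mgf_add (hX : IsLevyProcess X P) (s t : ℝ≥0) (u : ℝ) :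
    mgf (X (s + t)) P u = mgf (X s) P u * mgf (X t) P u := by
  have hm := hX.measurable
  have h := (hX.indepFun_sub s t).mgf_add' (t := u) (hm s).aestronglyMeasurable
    ((hm (s + t)).sub (hm s)).aestronglyMeasurable
  rwa [add_sub_cancel, mgf_congr_identDistrib (hX.identDistrib_sub s t)] at h

theorem integral_cexp_mul_cexp_sub (hX : IsLevyProcess X P) (s t : ℝ≥0) (z w : ℂ) :
    ∫ ω, Complex.exp (z * X s ω) * Complex.exp (w * ((X (s + t) - X s) ω : ℝ)) ∂P =
      complexMGF (X s) P z * complexMGF (X t) P w := by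
  have hm := hX.measurable
  rw [← complexMGF_congr_identDistrib (hX.identDistrib_sub s t)]
  exact (hX.indepFun_sub s t).integral_fun_comp_mul_comp
    (f := fun x : ℝ ↦ Complex.exp (z * x)) (g := fun x : ℝ ↦ Complex.exp (w * x))
    (hm s).aemeasurable ((hm (s + t)).sub (hm s)).aemeasurable
    (by fun_prop) (by fun_prop)

theorem complexMGF_add (hX : IsLevyProcess X P) (s t : ℝ≥0) (z : ℂ) :
    complexMGF (X (s + t)) P z = complexMGF (X s) P z * complexMGF (X t) P z := by
  rw [← hX.integral_cexp_mul_cexp_sub s t z z, complexMGF]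
  congr with ω
  rw [← Complex.exp_add, Pi.sub_apply]
  push_cast
  ring_nf

variable [IsProbabilityMeasure P]

theorem integral_comp_zero {E : Type*} [NormedAddCommGroup E] [NormedSpace ℝ E] [CompleteSpace E]
    (hX : IsLevyProcess X P) (g : ℝ → E) : ∫ ω, g (X 0 ω) ∂P = g 0 := by
  have h_ae : (fun ω ↦ g (X 0 ω)) =ᵐ[P] fun _ ↦ g 0 := by
    filter_upwards [hX.zero] with ω hω
    rw [hω]
  rw [integral_congr_ae h_ae]
  simp

theorem complexMGF_zero (hX : IsLevyProcess X P) (z : ℂ) : complexMGF (X 0) P z = 1 := by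
  simpa [complexMGF] using hX.integral_comp_zero fun x ↦ Complex.exp (z * x)

theorem exists_forall_half_le_mgf (hX : IsLevyProcess X P) {u : ℝ}
    (hu : u ∈ integrableExpSet (X 1) P) :
    ∃ δ : ℝ≥0, 0 < δ ∧ ∀ t ≤ δ, 1 / 2 ≤ mgf (X t) P u := by
  have h_min : ∀ x, ‖min 1 (Real.exp (u * x))‖ ≤ 1 := fun x ↦ by
    rw [Real.norm_of_nonneg (le_min zero_le_one (Real.exp_pos _).le)]
    exact min_le_left _ _
  have h_lim : Tendsto (fun t ↦ ∫ ω, 1 * min 1 (Real.exp (u * X t ω)) ∂P) (𝓝 0) (𝓝 1) := by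
    have h_zero : ∫ ω, 1 * min 1 (Real.exp (u * X 0 ω)) ∂P = 1 := by
      simpa using hX.integral_comp_zero fun x ↦ min 1 (Real.exp (u * x))
    simpa only [h_zero] using tendsto_integral_mul_of_tendstoInMeasure
      (fun t ↦ (hX.measurable t).aemeasurable) (hX.stochastically_continuous 0)
      (integrable_const (1 : ℝ)) (φ := fun x ↦ min 1 (Real.exp (u * x))) (by fun_prop) h_min
  obtain ⟨ε, hε, h_ball⟩ := Metric.eventually_nhds_iff.1
    (h_lim.eventually (lt_mem_nhds (one_half_lt_one (α := ℝ))))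
  refine ⟨⟨ε / 2, by positivity⟩, (half_pos hε : 0 < ε / 2), fun t ht ↦ ?_⟩
  have h_dist : dist t 0 < ε := by
    rw [NNReal.dist_eq, NNReal.coe_zero, sub_zero, abs_of_nonneg t.coe_nonneg]
    exact (show (t : ℝ) ≤ ε / 2 from ht).trans_lt (half_lt_self hε)
  refine (h_ball h_dist).le.trans (integral_mono_of_nonneg (ae_of_all _ fun ω ↦ ?_)
    (hX.integrable_exp_mul hu t) (ae_of_all _ fun ω ↦ ?_))
  · simp [(Real.exp_pos (u * X t ω)).le]
  · simp

theorem mgf_pos (hX : IsLevyProcess X P) {u : ℝ} (hu : u ∈ integrableExpSet (X 1) P) (t : ℝ≥0) :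
    0 < mgf (X t) P u :=
  ProbabilityTheory.mgf_pos (hX.integrable_exp_mul hu t)

theorem continuous_mgf (hX : IsLevyProcess X P) {u : ℝ} (hu : u ∈ integrableExpSet (X 1) P) :
    Continuous (fun t ↦ mgf (X t) P u) := by
  obtain ⟨δ, hδ, hδ_le⟩ := hX.exists_forall_half_le_mgf hu
  exact continuous_of_map_add_eq_mul_of_forall_le (hX.mgf_pos hu) (fun s t ↦ hX.mgf_add s t u)
    hδ one_half_pos hδ_le

-- `|e ^ (z X_s)|` is dominated uniformly in `s` only after a change of measure with density
-- proportional to `e ^ (Re z X_T)`, under which `X_T - X_s` integrates out to a moment generating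
-- function.
theorem complexMGF_eq_integral_div (hX : IsLevyProcess X P) {z : ℂ}
    (hz : z.re ∈ integrableExpSet (X 1) P) {s T : ℝ≥0} (hsT : s ≤ T) :
    complexMGF (X s) P z = (∫ ω, ((Real.exp (z.re * X T ω) : ℝ) : ℂ) *
      Complex.exp (((z.im * X s ω : ℝ) : ℂ) * Complex.I) ∂P) / mgf (X (T - s)) P z.re := by
  rw [eq_div_iff (by exact_mod_cast (hX.mgf_pos hz (T - s)).ne'), ← complexMGF_ofReal,
    ← hX.integral_cexp_mul_cexp_sub s (T - s), add_tsub_cancel_of_le hsT]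
  congr with ω
  rw [Complex.ofReal_exp, ← Complex.exp_add, ← Complex.exp_add, Pi.sub_apply]
  congr 1
  push_cast
  linear_combination -(X s ω : ℂ) * Complex.re_add_im z

theorem continuous_complexMGF (hX : IsLevyProcess X P) {z : ℂ}
    (hz : z.re ∈ integrableExpSet (X 1) P) : Continuous (fun t ↦ complexMGF (X t) P z) := by
  refine continuous_iff_continuousAt.2 fun t ↦ ?_
  have htT : t < t + 1 := lt_add_one t
  have h_num := tendsto_integral_mul_of_tendstoInMeasure (𝕜 := ℂ)
    (fun t ↦ (hX.measurable t).aemeasurable) (hX.stochastically_continuous t)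
    (hX.integrable_exp_mul hz (t + 1)).ofReal
    (φ := fun x ↦ Complex.exp (((z.im * x : ℝ) : ℂ) * Complex.I)) (by fun_prop)
    (fun x ↦ (Complex.norm_exp_ofReal_mul_I _).le)
  have h_den : Tendsto (fun s ↦ ((mgf (X (t + 1 - s)) P z.re : ℝ) : ℂ)) (𝓝 t)
      (𝓝 (mgf (X (t + 1 - t)) P z.re : ℝ)) :=
    (Complex.continuous_ofReal.comp ((hX.continuous_mgf hz).comp
      (continuous_const.sub continuous_id))).tendsto t
  rw [ContinuousAt, hX.complexMGF_eq_integral_div hz htT.le]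
  refine (h_num.div h_den (by exact_mod_cast (hX.mgf_pos hz _).ne')).congr' ?_
  filter_upwards [Iio_mem_nhds htT] with s hs
  exact (hX.complexMGF_eq_integral_div hz (le_of_lt hs)).symm

end IsLevyProcess

theorem exists_Icc_mem_nhdsWithin {α : Type*} [LinearOrder α] [TopologicalSpace α] [OrderTopology α]
    {s : Set α} {x : α} (hx : x ∈ s) : ∃ a ∈ s, ∃ b ∈ s, Icc a b ∈ 𝓝[s] x := by
  have h_left : ∃ a ∈ s, Ici a ∈ 𝓝[s] x := by
    by_cases! h : ∃ a ∈ s, a < x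
    · obtain ⟨a, ha, hax⟩ := h
      exact ⟨a, ha, mem_nhdsWithin_of_mem_nhds (Ici_mem_nhds hax)⟩
    · exact ⟨x, hx, mem_of_superset self_mem_nhdsWithin h⟩
  have h_right : ∃ b ∈ s, Iic b ∈ 𝓝[s] x := by
    by_cases! h : ∃ b ∈ s, x < b
    · obtain ⟨b, hb, hxb⟩ := h
      exact ⟨b, hb, mem_nhdsWithin_of_mem_nhds (Iic_mem_nhds hxb)⟩
    · exact ⟨x, hx, mem_of_superset self_mem_nhdsWithin h⟩
  obtain ⟨a, ha, hal⟩ := h_left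
  obtain ⟨b, hb, hbl⟩ := h_right
  exact ⟨a, ha, b, hb, inter_mem hal hbl⟩

theorem expDomain_eq_preimage {Ω : Type*} [MeasurableSpace Ω] (Y : ℝ≥0 → Ω → ℝ) (P : Measure Ω) :
    expDomain Y P = Complex.re ⁻¹' integrableExpSet (Y 1) P := rfl

theorem exists_eventually_re_mem_Icc_of_mem_expDomain {Ω : Type*} [MeasurableSpace Ω]
    {Y : ℝ≥0 → Ω → ℝ} {P : Measure Ω} {z : ℂ} (hz : z ∈ expDomain Y P) :
    ∃ a ∈ integrableExpSet (Y 1) P, ∃ b ∈ integrableExpSet (Y 1) P,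
      ∀ᶠ w in 𝓝[expDomain Y P] z, w.re ∈ Icc a b := by
  obtain ⟨a, ha, b, hb, hab⟩ :=
    exists_Icc_mem_nhdsWithin (s := integrableExpSet (Y 1) P) (x := z.re) hz
  exact ⟨a, ha, b, hb, (Complex.continuous_re.continuousWithinAt.tendsto_nhdsWithin
    (mapsTo_preimage _ _)).eventually hab⟩

namespace IsLevyProcess

variable {Ω : Type*} [MeasurableSpace Ω] {P : Measure Ω} [IsProbabilityMeasure P] {X : ℝ≥0 → Ω → ℝ}

theorem continuousOn_complexMGF (hX : IsLevyProcess X P) (t : ℝ≥0) :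
    ContinuousOn (complexMGF (X t) P) (expDomain X P) := by
  intro z hz
  obtain ⟨a, ha, b, hb, hab⟩ := exists_eventually_re_mem_Icc_of_mem_expDomain hz
  have hm := hX.measurable t
  refine tendsto_integral_filter_of_dominated_convergence
    (fun ω ↦ Real.exp (a * X t ω) + Real.exp (b * X t ω))
    (Eventually.of_forall fun w ↦ Measurable.aestronglyMeasurable (by fun_prop)) ?_
    ((hX.integrable_exp_mul ha t).add (hX.integrable_exp_mul hb t))
    (ae_of_all _ fun ω ↦ Continuous.continuousWithinAt (by fun_prop))
  filter_upwards [hab] with w hw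
  refine ae_of_all _ fun ω ↦ ?_
  rw [Complex.norm_exp, Complex.re_mul_ofReal]
  exact exp_mul_le_add_of_mem_Icc hw _

theorem norm_complexMGF_le_add (hX : IsLevyProcess X P) {a b : ℝ}
    (ha : a ∈ integrableExpSet (X 1) P) (hb : b ∈ integrableExpSet (X 1) P) {z : ℂ}
    (hz : z.re ∈ Icc a b) (t : ℝ≥0) :
    ‖complexMGF (X t) P z‖ ≤ mgf (X t) P a + mgf (X t) P b := by
  have hae := hX.integrable_exp_mul ha t
  have hbe := hX.integrable_exp_mul hb t
  refine norm_complexMGF_le_mgf.trans ?_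
  rw [mgf, mgf, mgf, ← integral_add hae hbe]
  exact integral_mono_of_nonneg (ae_of_all _ fun ω ↦ (Real.exp_pos _).le) (hae.add hbe)
    (ae_of_all _ fun ω ↦ exp_mul_le_add_of_mem_Icc hz _)

theorem continuousOn_integral_complexMGF (hX : IsLevyProcess X P) (δ : ℝ≥0) :
    ContinuousOn (fun z ↦ ∫ s in (0 : ℝ)..δ, complexMGF (X s.toNNReal) P z) (expDomain X P) := by
  intro z hz
  obtain ⟨a, ha, b, hb, hab⟩ := exists_eventually_re_mem_Icc_of_mem_expDomain hz
  refine intervalIntegral.continuousWithinAt_of_dominated_interval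
    (bound := fun s ↦ mgf (X s.toNNReal) P a + mgf (X s.toNNReal) P b) ?_ ?_ ?_
    (ae_of_all _ fun s _ ↦ hX.continuousOn_complexMGF _ z hz)
  · filter_upwards [self_mem_nhdsWithin] with w hw
    exact ((hX.continuous_complexMGF hw).comp continuous_real_toNNReal).aestronglyMeasurable
  · filter_upwards [hab] with w hw
    exact ae_of_all _ fun s _ ↦ hX.norm_complexMGF_le_add ha hb hw _
  · exact (((hX.continuous_mgf ha).comp continuous_real_toNNReal).add
      ((hX.continuous_mgf hb).comp continuous_real_toNNReal)).intervalIntegrable _ _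

theorem exists_integral_complexMGF_ne_zero (hX : IsLevyProcess X P) {z : ℂ}
    (hz : z ∈ expDomain X P) :
    ∃ δ : ℝ≥0, ∫ s in (0 : ℝ)..δ, complexMGF (X s.toNNReal) P z ≠ 0 :=
  exists_integral_ne_zero_of_continuous (hX.continuous_complexMGF hz) (by simp [hX.complexMGF_zero])

theorem complexMGF_eq_cexp (hX : IsLevyProcess X P) {z : ℂ} (hz : z ∈ expDomain X P) {δ : ℝ≥0}
    (hδ : ∫ s in (0 : ℝ)..δ, complexMGF (X s.toNNReal) P z ≠ 0) (t : ℝ≥0) :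
    complexMGF (X t) P z = Complex.exp (t * ((complexMGF (X δ) P z - 1) /
      ∫ s in (0 : ℝ)..δ, complexMGF (X s.toNNReal) P z)) :=
  eq_cexp_of_continuous_of_map_add_eq_mul (hX.continuous_complexMGF hz) (hX.complexMGF_zero z)
    (fun s t ↦ hX.complexMGF_add s t z) hδ t

theorem exists_isCumulantGenFun (hX : IsLevyProcess X P) : ∃ κ, IsCumulantGenFun X P κ := by
  have h_exists : ∀ z ∈ expDomain X P,
      ∃ k : ℂ, ∀ t : ℝ≥0, complexMGF (X t) P z = Complex.exp (t * k) := fun z hz ↦ by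
    obtain ⟨δ, hδ⟩ := hX.exists_integral_complexMGF_ne_zero hz
    exact ⟨_, hX.complexMGF_eq_cexp hz hδ⟩
  choose! κ hκ using h_exists
  refine ⟨κ, fun z hz ↦ ?_, fun t z hz ↦ hκ z hz t⟩
  obtain ⟨δ, hδ⟩ := hX.exists_integral_complexMGF_ne_zero hz
  have h_int := hX.continuousOn_integral_complexMGF δ z hz
  have h_rate : ∀ w ∈ expDomain X P, ∫ s in (0 : ℝ)..δ, complexMGF (X s.toNNReal) P w ≠ 0 →
      κ w = (complexMGF (X δ) P w - 1) / ∫ s in (0 : ℝ)..δ, complexMGF (X s.toNNReal) P w :=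
    fun w hw hwδ ↦ eq_of_forall_cexp_mul_eq fun t ↦
      (hκ w hw t).symm.trans (hX.complexMGF_eq_cexp hw hwδ t)
  refine ContinuousWithinAt.congr_of_eventuallyEq
    (((hX.continuousOn_complexMGF δ z hz).sub continuousWithinAt_const).div h_int hδ) ?_
    (h_rate z hz hδ)
  filter_upwards [h_int.eventually_ne hδ, self_mem_nhdsWithin] with w hw hwD
  exact h_rate w hwD hw

end IsLevyProcess

section WithinDerivatives

variable {𝕜 E : Type*} [RCLike 𝕜] [NormedAddCommGroup E] [NormedSpace 𝕜 E]

theorem hasDerivWithinAt_integral_of_dominated_of_convex {α : Type*} [MeasurableSpace α]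
    [NormedSpace ℝ E] {ν : Measure α} {s : Set 𝕜} (hs : Convex ℝ s) {F F' : 𝕜 → α → E}
    {bound : α → ℝ} (hF : ∀ x ∈ s, Integrable (F x) ν) (hbound : Integrable bound ν)
    (hderiv : ∀ᵐ a ∂ν, ∀ x ∈ s, HasDerivWithinAt (fun x ↦ F x a) (F' x a) s x)
    (hle : ∀ᵐ a ∂ν, ∀ x ∈ s, ‖F' x a‖ ≤ bound a) {x₀ : 𝕜} (hx₀ : x₀ ∈ s) :
    HasDerivWithinAt (fun x ↦ ∫ a, F x a ∂ν) (∫ a, F' x₀ a ∂ν) s x₀ := by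
  rw [hasDerivWithinAt_iff_tendsto_slope]
  have h_slope : ∀ x ∈ s, slope (fun x ↦ ∫ a, F x a ∂ν) x₀ x =
      ∫ a, slope (fun x ↦ F x a) x₀ x ∂ν := fun x hx ↦ by
    simp only [slope_def_module]
    rw [integral_smul, integral_sub (hF x hx) (hF x₀ hx₀)]
  have h_mem : ∀ᶠ x in 𝓝[s \ {x₀}] x₀, x ∈ s \ {x₀} := self_mem_nhdsWithin
  refine Tendsto.congr' (h_mem.mono fun x hx ↦ (h_slope x hx.1).symm) ?_
  refine tendsto_integral_filter_of_dominated_convergence bound (h_mem.mono fun x hx ↦ ?_)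
    (h_mem.mono fun x hx ↦ ?_) hbound ?_
  · simp only [slope_def_module]
    exact ((hF x hx.1).sub (hF x₀ hx₀)).1.const_smul _
  · filter_upwards [hderiv, hle] with a hda hla
    have hpos : 0 < ‖x - x₀‖ := norm_pos_iff.2 (sub_ne_zero.2 hx.2)
    rw [slope_def_module, norm_smul, norm_inv, inv_mul_le_iff₀ hpos, mul_comm]
    exact hs.norm_image_sub_le_of_norm_hasDerivWithin_le hda hla hx₀ hx.1
  · filter_upwards [hderiv] with a hda
    exact hasDerivWithinAt_iff_tendsto_slope.1 (hda x₀ hx₀)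

variable {s : Set 𝕜} {D : ℕ → 𝕜 → E} {N : ℕ}

theorem iteratedDerivWithin_eq_of_hasDerivWithinAt (hs : UniqueDiffOn 𝕜 s)
    (hD : ∀ n < N, ∀ x ∈ s, HasDerivWithinAt (D n) (D (n + 1) x) s x) {n : ℕ} (hn : n ≤ N) :
    EqOn (iteratedDerivWithin n (D 0) s) (D n) s := by
  induction n with
  | zero => simp [EqOn]
  | succ n ih =>
    intro x hx
    have h_eq := ih (Nat.le_of_succ_le hn)
    rw [iteratedDerivWithin_succ, derivWithin_congr h_eq (h_eq hx)]
    exact (hD n hn x hx).derivWithin (hs x hx)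

theorem contDiffOn_of_hasDerivWithinAt (hs : UniqueDiffOn 𝕜 s)
    (hD : ∀ n < N, ∀ x ∈ s, HasDerivWithinAt (D n) (D (n + 1) x) s x)
    (hcont : ContinuousOn (D N) s) : ContDiffOn 𝕜 N (D 0) s := by
  have h_eq {n : ℕ} (hn : n ≤ N) := iteratedDerivWithin_eq_of_hasDerivWithinAt hs hD hn
  refine (contDiffOn_nat_iff_continuousOn_differentiableOn_deriv hs).2
    ⟨fun n hn ↦ ?_, fun n hn ↦ ?_⟩
  · refine ContinuousOn.congr ?_ (h_eq hn)
    rcases hn.lt_or_eq with h | rfl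
    · exact fun x hx ↦ (hD n h x hx).continuousWithinAt
    · exact hcont
  · exact fun x hx ↦ ((hD n hn x hx).congr (h_eq hn.le) (h_eq hn.le hx)).differentiableWithinAt

end WithinDerivatives

section ExponentialDerivatives

variable {f : ℂ → ℂ} {s : Set ℂ} {z : ℂ}

theorem contDiffOn_of_cexp_eq {g : ℂ → ℂ} {n : WithTop ℕ∞} (hf : ContinuousOn f s)
    (hg : ContDiffOn ℂ n g s) (hfg : ∀ w ∈ s, Complex.exp (f w) = g w) : ContDiffOn ℂ n f s := by
  intro z hz
  have hgz : g z ≠ 0 := hfg z hz ▸ Complex.exp_ne_zero _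
  have h_log : ContDiffWithinAt ℂ n (fun w ↦ f z + Complex.log (g w / g z)) s z := by
    have h_slit : g z / g z ∈ Complex.slitPlane := by simp [hgz]
    exact contDiffWithinAt_const.add ((Complex.contDiffAt_log h_slit).comp_contDiffWithinAt
      (f := fun w ↦ g w / g z) z ((hg z hz).div_const _))
  have h_im : Tendsto (fun w ↦ (f w - f z).im) (𝓝[s] z) (𝓝 0) := by
    simpa [Function.comp_def] using (Complex.continuous_im.tendsto _).comp
      ((hf z hz).sub (continuousWithinAt_const (b := f z)))
  refine h_log.congr_of_eventuallyEq ?_ (by simp [hgz])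
  filter_upwards [h_im.eventually (Ioo_mem_nhds (neg_neg_of_pos Real.pi_pos) Real.pi_pos),
    self_mem_nhdsWithin] with w hw hws
  rw [← hfg w hws, ← hfg z hz, ← Complex.exp_sub, Complex.log_exp hw.1 hw.2.le]
  ring

theorem iteratedDerivWithin_succ_cexp (hs : UniqueDiffOn ℂ s) {n : ℕ}
    (hf : ContDiffOn ℂ (n + 1) f s) (hz : z ∈ s) :
    iteratedDerivWithin (n + 1) (fun w ↦ Complex.exp (f w)) s z =
      ∑ j ∈ Finset.range (n + 1), n.choose j * iteratedDerivWithin (j + 1) f s z *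
        iteratedDerivWithin (n - j) (fun w ↦ Complex.exp (f w)) s z := by
  have h_deriv : EqOn (derivWithin (fun w ↦ Complex.exp (f w)) s)
      (derivWithin f s * fun w ↦ Complex.exp (f w)) s := fun w hw ↦ by
    have hfw : DifferentiableWithinAt ℂ f s w := hf.differentiableOn (by simp) w hw
    rw [hfw.hasDerivWithinAt.cexp.derivWithin (hs w hw), Pi.mul_apply, mul_comm]
  rw [iteratedDerivWithin_succ', iteratedDerivWithin_congr h_deriv hz,
    iteratedDerivWithin_mul hz hs (hf.derivWithin hs le_rfl z hz)
      ((hf.of_le (by simp)).cexp z hz)]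
  simp_rw [iteratedDerivWithin_succ']

theorem iteratedDerivWithin_succ_cexp_mul (hs : UniqueDiffOn ℂ s) {n : ℕ}
    (hf : ContDiffOn ℂ (n + 1) f s) (hz : z ∈ s) (t : ℂ) :
    iteratedDerivWithin (n + 1) (fun w ↦ Complex.exp (t * f w)) s z =
      t * ∑ j ∈ Finset.range (n + 1), n.choose j * iteratedDerivWithin (j + 1) f s z *
        iteratedDerivWithin (n - j) (fun w ↦ Complex.exp (t * f w)) s z := by
  rw [iteratedDerivWithin_succ_cexp hs (contDiffOn_const.mul hf) hz, Finset.mul_sum]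
  refine Finset.sum_congr rfl fun j _ ↦ ?_
  rw [iteratedDerivWithin_const_mul_field]
  ring

theorem tendsto_iteratedDerivWithin_cexp_mul (hs : UniqueDiffOn ℂ s) {n : ℕ}
    (hf : ContDiffOn ℂ n f s) (hz : z ∈ s) :
    Tendsto (fun t : ℂ ↦ iteratedDerivWithin n (fun w ↦ Complex.exp (t * f w)) s z) (𝓝 0)
      (𝓝 (if n = 0 then 1 else 0)) := by
  induction n using Nat.strong_induction_on with
  | _ n ih =>
    cases n with
    | zero =>
      have h_cont : Continuous fun t : ℂ ↦ Complex.exp (t * f z) := by fun_prop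
      simpa using h_cont.tendsto 0
    | succ n =>
      simp_rw [iteratedDerivWithin_succ_cexp_mul hs (by exact_mod_cast hf) hz]
      rw [if_neg n.succ_ne_zero]
      have h_sum := tendsto_finsetSum (Finset.range (n + 1)) fun j _ ↦
        (ih (n - j) (by lia) (hf.of_le (by exact_mod_cast (by lia : n - j ≤ n + 1)))).const_mul
          (n.choose j * iteratedDerivWithin (j + 1) f s z)
      simpa using tendsto_id.mul h_sum

theorem tendsto_inv_mul_iteratedDerivWithin_cexp_mul (hs : UniqueDiffOn ℂ s) {n : ℕ} (hn : n ≠ 0)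
    (hf : ContDiffOn ℂ n f s) (hz : z ∈ s) :
    Tendsto (fun t : ℂ ↦ t⁻¹ * iteratedDerivWithin n (fun w ↦ Complex.exp (t * f w)) s z) (𝓝[≠] 0)
      (𝓝 (iteratedDerivWithin n f s z)) := by
  obtain ⟨n, rfl⟩ := Nat.exists_eq_succ_of_ne_zero hn
  have h_sum := tendsto_finsetSum (Finset.range (n + 1)) fun j _ ↦
    (tendsto_iteratedDerivWithin_cexp_mul hs (hf.of_le
      (by exact_mod_cast (by lia : n - j ≤ n + 1))) hz).const_mul
        (n.choose j * iteratedDerivWithin (j + 1) f s z)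
  have h_limit : ∑ j ∈ Finset.range (n + 1), n.choose j * iteratedDerivWithin (j + 1) f s z *
      (if n - j = 0 then 1 else 0) = iteratedDerivWithin (n + 1) f s z := by
    rw [Finset.sum_range_succ, Finset.sum_eq_zero fun j hj ↦ ?_]
    · simp
    · rw [if_neg (Nat.sub_ne_zero_of_lt (Finset.mem_range.1 hj)), mul_zero]
  rw [h_limit] at h_sum
  refine (h_sum.mono_left nhdsWithin_le_nhds).congr' ?_
  filter_upwards [self_mem_nhdsWithin] with t ht
  rw [iteratedDerivWithin_succ_cexp_mul hs (by exact_mod_cast hf) hz, inv_mul_cancel_left₀ ht]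

end ExponentialDerivatives

theorem uniqueDiffOn_of_convex_of_nontrivial {𝕜 : Type*} [RCLike 𝕜] {s : Set 𝕜}
    (hs : Convex ℝ s) (hs' : s.Nontrivial) : UniqueDiffOn 𝕜 s := fun x hx ↦
  (hs.isPreconnected.preperfect_of_nontrivial hs' x hx).uniqueDiffWithinAt

/-- The closed vertical strip in `ℂ` between the imaginary axis and the line `Re z = a`, where `a`
may have either sign and may vanish. -/
def verticalStrip (a : ℝ) : Set ℂ :=
  Complex.re ⁻¹' uIcc 0 a

theorem convex_verticalStrip (a : ℝ) : Convex ℝ (verticalStrip a) :=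
  (convex_uIcc 0 a).is_linear_preimage Complex.reLm.isLinear

theorem zero_mem_verticalStrip (a : ℝ) : 0 ∈ verticalStrip a := by
  simp [verticalStrip]

theorem uniqueDiffOn_verticalStrip (a : ℝ) : UniqueDiffOn ℂ (verticalStrip a) :=
  uniqueDiffOn_of_convex_of_nontrivial (convex_verticalStrip a)
    ⟨0, zero_mem_verticalStrip a, Complex.I, by simp [verticalStrip], Complex.I_ne_zero.symm⟩

theorem norm_ofReal_pow_mul_cexp (n : ℕ) (z : ℂ) (x : ℝ) :
    ‖(x : ℂ) ^ n * Complex.exp (z * x)‖ = |x| ^ n * Real.exp (z.re * x) := by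
  rw [norm_mul, norm_pow, Complex.norm_real, Real.norm_eq_abs, Complex.norm_exp,
    Complex.re_mul_ofReal]

section ComplexMGF

variable {Ω : Type*} [MeasurableSpace Ω] {P : Measure Ω} {Y : Ω → ℝ} {N n : ℕ} {a : ℝ}

theorem norm_ofReal_pow_mul_cexp_le_polyExpWeight (hn : n ≤ N) {z : ℂ} (hz : z ∈ verticalStrip a)
    (x : ℝ) : ‖(x : ℂ) ^ n * Complex.exp (z * x)‖ ≤ polyExpWeight N a x :=
  (norm_ofReal_pow_mul_cexp n z x).trans_le (abs_pow_mul_exp_le_polyExpWeight hn hz x)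

theorem integrable_pow_mul_cexp (hY : AEMeasurable Y P)
    (h : Integrable (fun ω ↦ polyExpWeight N a (Y ω)) P) (hn : n ≤ N) {z : ℂ}
    (hz : z ∈ verticalStrip a) :
    Integrable (fun ω ↦ (Y ω : ℂ) ^ n * Complex.exp (z * Y ω)) P :=
  h.mono' (AEMeasurable.aestronglyMeasurable (by fun_prop))
    (ae_of_all _ fun ω ↦ norm_ofReal_pow_mul_cexp_le_polyExpWeight hn hz (Y ω))

theorem continuousOn_integral_pow_mul_cexp (hY : AEMeasurable Y P)
    (h : Integrable (fun ω ↦ polyExpWeight N a (Y ω)) P) (hn : n ≤ N) :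
    ContinuousOn (fun z ↦ ∫ ω, (Y ω : ℂ) ^ n * Complex.exp (z * Y ω) ∂P) (verticalStrip a) :=
  continuousOn_of_dominated (fun z hz ↦ (integrable_pow_mul_cexp hY h hn hz).1)
    (fun z hz ↦ ae_of_all _ fun ω ↦ norm_ofReal_pow_mul_cexp_le_polyExpWeight hn hz (Y ω)) h
    (ae_of_all _ fun ω ↦ by fun_prop)

theorem hasDerivWithinAt_integral_pow_mul_cexp (hY : AEMeasurable Y P)
    (h : Integrable (fun ω ↦ polyExpWeight N a (Y ω)) P) (hn : n < N) {z : ℂ}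
    (hz : z ∈ verticalStrip a) :
    HasDerivWithinAt (fun z ↦ ∫ ω, (Y ω : ℂ) ^ n * Complex.exp (z * Y ω) ∂P)
      (∫ ω, (Y ω : ℂ) ^ (n + 1) * Complex.exp (z * Y ω) ∂P) (verticalStrip a) z := by
  refine hasDerivWithinAt_integral_of_dominated_of_convex (convex_verticalStrip a)
    (F' := fun z ω ↦ (Y ω : ℂ) ^ (n + 1) * Complex.exp (z * Y ω))
    (fun w hw ↦ integrable_pow_mul_cexp hY h hn.le hw) h (ae_of_all _ fun ω w _ ↦ ?_)
    (ae_of_all _ fun ω w hw ↦ norm_ofReal_pow_mul_cexp_le_polyExpWeight hn hw (Y ω)) hz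
  refine ((((hasDerivAt_id w).mul_const (Y ω : ℂ)).cexp.const_mul
    ((Y ω : ℂ) ^ n)).congr_deriv ?_).hasDerivWithinAt
  simp only [id_eq]
  ring

theorem complexMGF_eq_integral_pow_zero :
    complexMGF Y P = fun z ↦ ∫ ω, (Y ω : ℂ) ^ 0 * Complex.exp (z * Y ω) ∂P := by
  ext z
  simp [complexMGF]

theorem contDiffOn_complexMGF (hY : AEMeasurable Y P)
    (h : Integrable (fun ω ↦ polyExpWeight N a (Y ω)) P) :
    ContDiffOn ℂ N (complexMGF Y P) (verticalStrip a) := by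
  rw [complexMGF_eq_integral_pow_zero]
  exact contDiffOn_of_hasDerivWithinAt (uniqueDiffOn_verticalStrip a)
    (D := fun n z ↦ ∫ ω, (Y ω : ℂ) ^ n * Complex.exp (z * Y ω) ∂P)
    (fun n hn z hz ↦ hasDerivWithinAt_integral_pow_mul_cexp hY h hn hz)
    (continuousOn_integral_pow_mul_cexp hY h le_rfl)

theorem iteratedDerivWithin_complexMGF (hY : AEMeasurable Y P)
    (h : Integrable (fun ω ↦ polyExpWeight N a (Y ω)) P) (hn : n ≤ N) {z : ℂ}
    (hz : z ∈ verticalStrip a) :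
    iteratedDerivWithin n (complexMGF Y P) (verticalStrip a) z =
      ∫ ω, (Y ω : ℂ) ^ n * Complex.exp (z * Y ω) ∂P := by
  rw [complexMGF_eq_integral_pow_zero]
  exact iteratedDerivWithin_eq_of_hasDerivWithinAt (uniqueDiffOn_verticalStrip a)
    (D := fun n z ↦ ∫ ω, (Y ω : ℂ) ^ n * Complex.exp (z * Y ω) ∂P)
    (fun n hn z hz ↦ hasDerivWithinAt_integral_pow_mul_cexp hY h hn hz) hn hz

end ComplexMGF

section NormBounds

variable {Ω : Type*} [MeasurableSpace Ω] {P : Measure Ω} {Y : Ω → ℝ} {m n N : ℕ} {a : ℝ} {z : ℂ}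

theorem norm_integral_pow_mul_cexp_le :
    ‖∫ ω, (Y ω : ℂ) ^ n * Complex.exp (z * Y ω) ∂P‖ ≤ ∫ ω, |Y ω| ^ n * Real.exp (z.re * Y ω) ∂P :=
  (norm_integral_le_integral_norm _).trans_eq (by simp only [norm_ofReal_pow_mul_cexp])

theorem norm_integral_pow_mul_cexp_ofReal_of_even (hn : Even n) (u : ℝ) :
    ‖∫ ω, (Y ω : ℂ) ^ n * Complex.exp (u * Y ω) ∂P‖ = ∫ ω, |Y ω| ^ n * Real.exp (u * Y ω) ∂P := by
  have h_real : ∫ ω, (Y ω : ℂ) ^ n * Complex.exp (u * Y ω) ∂P =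
      ((∫ ω, |Y ω| ^ n * Real.exp (u * Y ω) ∂P : ℝ) : ℂ) := by
    rw [← integral_complex_ofReal]
    simp [hn.pow_abs]
  rw [h_real, Complex.norm_of_nonneg (integral_nonneg fun ω ↦ by positivity)]

theorem integrable_abs_pow_mul_exp (hY : AEMeasurable Y P)
    (h : Integrable (fun ω ↦ polyExpWeight N a (Y ω)) P) (hn : n ≤ N) {u : ℝ} (hu : u ∈ uIcc 0 a) :
    Integrable (fun ω ↦ |Y ω| ^ n * Real.exp (u * Y ω)) P :=
  h.mono' (AEMeasurable.aestronglyMeasurable (by fun_prop)) (ae_of_all _ fun ω ↦ by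
    rw [Real.norm_of_nonneg (by positivity)]
    exact abs_pow_mul_exp_le_polyExpWeight hn hu (Y ω))

theorem pow_le_pow_add_pow_of_mem_Icc (hn : n ∈ Icc m N) {x : ℝ} (hx : 0 ≤ x) :
    x ^ n ≤ x ^ m + x ^ N := by
  rcases le_total x 1 with h | h
  · exact (pow_le_pow_of_le_one hx h hn.1).trans (le_add_of_nonneg_right (by positivity))
  · exact (pow_le_pow_right₀ h hn.2).trans (le_add_of_nonneg_left (by positivity))

theorem norm_integral_pow_mul_cexp_le_add (hY : AEMeasurable Y P)
    (h : Integrable (fun ω ↦ polyExpWeight N a (Y ω)) P) (hm : Even m) (hN : Even N)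
    (hn : n ∈ Icc m N) (hz : z ∈ verticalStrip a) :
    ‖∫ ω, (Y ω : ℂ) ^ n * Complex.exp (z * Y ω) ∂P‖ ≤
      ‖∫ ω, (Y ω : ℂ) ^ m * Complex.exp (z.re * Y ω) ∂P‖ +
        ‖∫ ω, (Y ω : ℂ) ^ N * Complex.exp (z.re * Y ω) ∂P‖ := by
  have h_int {k : ℕ} (hk : k ≤ N) := integrable_abs_pow_mul_exp hY h hk hz
  rw [norm_integral_pow_mul_cexp_ofReal_of_even hm, norm_integral_pow_mul_cexp_ofReal_of_even hN,
    ← integral_add (h_int (hn.1.trans hn.2)) (h_int le_rfl)]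
  refine norm_integral_pow_mul_cexp_le.trans (integral_mono (h_int hn.2)
    ((h_int (hn.1.trans hn.2)).add (h_int le_rfl)) fun ω ↦ ?_)
  simp only [← add_mul]
  gcongr
  exact pow_le_pow_add_pow_of_mem_Icc hn (abs_nonneg _)

end NormBounds

section CumulantBounds

variable {Ω : Type*} [MeasurableSpace Ω] {P : Measure Ω} {X : ℝ≥0 → Ω → ℝ} {κ : ℂ → ℂ}
  {m n N : ℕ} {a : ℝ} {z : ℂ}

theorem verticalStrip_subset_expDomain (hX : AEMeasurable (X 1) P)
    (h : Integrable (fun ω ↦ polyExpWeight N a (X 1 ω)) P) :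
    verticalStrip a ⊆ expDomain X P := fun z hz ↦ by
  simpa [expDomain] using integrable_abs_pow_mul_exp hX h N.zero_le hz

theorem IsCumulantGenFun.cexp_eq_complexMGF (hκ : IsCumulantGenFun X P κ) (hz : z ∈ expDomain X P) :
    Complex.exp (κ z) = complexMGF (X 1) P z := by
  simpa [complexMGF] using (hκ.2 1 z hz).symm

theorem IsCumulantGenFun.contDiffOn (hκ : IsCumulantGenFun X P κ) (hX : AEMeasurable (X 1) P)
    (h : Integrable (fun ω ↦ polyExpWeight N a (X 1 ω)) P) :
    ContDiffOn ℂ N κ (verticalStrip a) := by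
  have h_sub := verticalStrip_subset_expDomain hX h
  exact contDiffOn_of_cexp_eq (hκ.1.mono h_sub) (contDiffOn_complexMGF hX h) fun z hz ↦
    hκ.cexp_eq_complexMGF (h_sub hz)

namespace IsLevyProcess

variable [IsProbabilityMeasure P]

theorem iteratedDerivWithin_cexp_mul_cumulantGenFun (hX : IsLevyProcess X P)
    (hκ : IsCumulantGenFun X P κ) (h : Integrable (fun ω ↦ polyExpWeight N a (X 1 ω)) P)
    (hn : n ≤ N) (hz : z ∈ verticalStrip a) (t : ℝ≥0) :
    iteratedDerivWithin n (fun w ↦ Complex.exp (t * κ w)) (verticalStrip a) z =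
      ∫ ω, (X t ω : ℂ) ^ n * Complex.exp (z * X t ω) ∂P := by
  have hm := fun t ↦ (hX.measurable t).aemeasurable (μ := P)
  rw [← iteratedDerivWithin_complexMGF (hm t) (hX.integrable_polyExpWeight h t) hn hz]
  exact iteratedDerivWithin_congr
    (fun w hw ↦ (hκ.2 t w (verticalStrip_subset_expDomain (hm 1) h hw)).symm) hz

theorem tendsto_inv_mul_integral_pow_mul_cexp (hX : IsLevyProcess X P)
    (hκ : IsCumulantGenFun X P κ) (h : Integrable (fun ω ↦ polyExpWeight N a (X 1 ω)) P)
    (hn₀ : n ≠ 0) (hn : n ≤ N) (hz : z ∈ verticalStrip a) :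
    Tendsto (fun t : ℝ≥0 ↦ (t : ℂ)⁻¹ * ∫ ω, (X t ω : ℂ) ^ n * Complex.exp (z * X t ω) ∂P) (𝓝[>] 0)
      (𝓝 (iteratedDerivWithin n κ (verticalStrip a) z)) := by
  have h_coe : Tendsto (fun t : ℝ≥0 ↦ (t : ℂ)) (𝓝[>] 0) (𝓝[≠] 0) := by
    refine tendsto_nhdsWithin_iff.2 ⟨?_, ?_⟩
    · have h_cont : Continuous fun t : ℝ≥0 ↦ (t : ℂ) := by fun_prop
      simpa using (h_cont.tendsto 0).mono_left nhdsWithin_le_nhds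
    · filter_upwards [self_mem_nhdsWithin] with t ht
      simpa using (ne_of_gt ht : t ≠ 0)
  have h_smooth : ContDiffOn ℂ n κ (verticalStrip a) :=
    (hκ.contDiffOn (hX.measurable 1).aemeasurable h).of_le (by exact_mod_cast hn)
  refine ((tendsto_inv_mul_iteratedDerivWithin_cexp_mul (uniqueDiffOn_verticalStrip a) hn₀
    h_smooth hz).comp h_coe).congr fun t ↦ ?_
  rw [Function.comp_apply, hX.iteratedDerivWithin_cexp_mul_cumulantGenFun hκ h hn hz]

theorem norm_iteratedDerivWithin_le_add (hX : IsLevyProcess X P) (hκ : IsCumulantGenFun X P κ)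
    (h : Integrable (fun ω ↦ polyExpWeight N a (X 1 ω)) P) (hm₀ : m ≠ 0) (hm : Even m)
    (hN : Even N) (hn : n ∈ Icc m N) (hz : z ∈ verticalStrip a) :
    ‖iteratedDerivWithin n κ (verticalStrip a) z‖ ≤
      ‖iteratedDerivWithin m κ (verticalStrip a) z.re‖ +
        ‖iteratedDerivWithin N κ (verticalStrip a) z.re‖ := by
  have h_lim {k : ℕ} (hk : k ∈ Icc m N) {w : ℂ} (hw : w ∈ verticalStrip a) :=
    (hX.tendsto_inv_mul_integral_pow_mul_cexp hκ h (by grind) hk.2 hw).norm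
  have hmN : m ≤ N := hn.1.trans hn.2
  have hz' : (z.re : ℂ) ∈ verticalStrip a := hz
  refine le_of_tendsto_of_tendsto' (h_lim hn hz) ((h_lim (left_mem_Icc.2 hmN) hz').add
    (h_lim (right_mem_Icc.2 hmN) hz')) fun t ↦ ?_
  simp only [norm_mul, ← mul_add]
  gcongr
  exact norm_integral_pow_mul_cexp_le_add (hX.measurable t).aemeasurable
    (hX.integrable_polyExpWeight h t) hm hN hn hz

theorem exists_norm_iteratedDerivWithin_le (hX : IsLevyProcess X P) (hκ : IsCumulantGenFun X P κ)
    (h : Integrable (fun ω ↦ polyExpWeight N a (X 1 ω)) P) (hm₀ : m ≠ 0) (hm : Even m)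
    (hN : Even N) :
    ∃ C, ∀ n ∈ Icc m N, ∀ z ∈ verticalStrip a,
      ‖iteratedDerivWithin n κ (verticalStrip a) z‖ ≤ C := by
  have h_segment {k : ℕ} (hk : k ≤ N) : ∃ C, ∀ u ∈ uIcc 0 a,
      ‖iteratedDerivWithin k κ (verticalStrip a) (u : ℝ)‖ ≤ C :=
    isCompact_uIcc.exists_bound_of_continuousOn
      (((hκ.contDiffOn (hX.measurable 1).aemeasurable h).continuousOn_iteratedDerivWithin
        (by exact_mod_cast hk) (uniqueDiffOn_verticalStrip a)).comp
          Complex.continuous_ofReal.continuousOn fun u hu ↦ hu)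
  rcases lt_or_ge N m with hNm | hmN
  · exact ⟨0, fun n hn ↦ absurd (hn.1.trans hn.2) hNm.not_ge⟩
  obtain ⟨C, hC⟩ := h_segment hmN
  obtain ⟨C', hC'⟩ := h_segment le_rfl
  exact ⟨C + C', fun n hn z hz ↦ (hX.norm_iteratedDerivWithin_le_add hκ h hm₀ hm hN hn hz).trans
    (add_le_add (hC _ hz) (hC' _ hz))⟩

end IsLevyProcess

end CumulantBounds

section CumulantsAtZero

theorem iteratedDerivWithin_of_iteratedDerivWithin_one_eq_zero {f : ℂ → ℂ} {s : Set ℂ} {z : ℂ}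
    (hs : UniqueDiffOn ℂ s) (hf : ContDiffOn ℂ 4 f s) (hz : z ∈ s) (h0 : f z = 0)
    (h1 : iteratedDerivWithin 1 f s z = 0) :
    iteratedDerivWithin 2 f s z = iteratedDerivWithin 2 (fun w ↦ Complex.exp (f w)) s z ∧
    iteratedDerivWithin 3 f s z = iteratedDerivWithin 3 (fun w ↦ Complex.exp (f w)) s z ∧
    iteratedDerivWithin 4 f s z = iteratedDerivWithin 4 (fun w ↦ Complex.exp (f w)) s z -
      3 * iteratedDerivWithin 2 (fun w ↦ Complex.exp (f w)) s z ^ 2 := by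
  have h_rec {n : ℕ} (hn : n + 1 ≤ 4) := iteratedDerivWithin_succ_cexp hs
    (hf.of_le (by exact_mod_cast hn : ((n + 1 : ℕ) : WithTop ℕ∞) ≤ 4)) hz
  have h_exp1 := h_rec (n := 0) (by simp)
  have h_exp2 := h_rec (n := 1) (by simp)
  have h_exp3 := h_rec (n := 2) (by simp)
  have h_exp4 := h_rec (n := 3) (by simp)
  simp only [Finset.sum_range_succ, Finset.sum_range_zero, Nat.choose, Nat.reduceAdd, Nat.reduceSub,
    h0, h1, Complex.exp_zero, iteratedDerivWithin_zero] at h_exp1 h_exp2 h_exp3 h_exp4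
  grind

variable {Ω : Type*} [MeasurableSpace Ω] {P : Measure Ω} {Y : Ω → ℝ} {N n : ℕ} {a : ℝ} {k : ℂ → ℂ}

theorem integrable_polyExpWeight_sub_const (hY : AEMeasurable Y P)
    (h : Integrable (fun ω ↦ polyExpWeight N a (Y ω)) P) (m : ℝ) :
    Integrable (fun ω ↦ polyExpWeight N a (Y ω - m)) P :=
  (h.mul_const (polyExpWeight N a (-m))).mono'
    (AEMeasurable.aestronglyMeasurable ((continuous_polyExpWeight N a).measurable.comp_aemeasurable
      (hY.sub_const m))) (ae_of_all _ fun ω ↦ by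
        rw [Real.norm_of_nonneg (polyExpWeight_pos N a _).le, sub_eq_add_neg]
        exact polyExpWeight_add_le N a (Y ω) (-m))

theorem iteratedDerivWithin_complexMGF_zero (hY : AEMeasurable Y P)
    (h : Integrable (fun ω ↦ polyExpWeight N a (Y ω)) P) (hn : n ≤ N) :
    iteratedDerivWithin n (complexMGF Y P) (verticalStrip a) 0 = ((∫ ω, Y ω ^ n ∂P : ℝ) : ℂ) := by
  rw [iteratedDerivWithin_complexMGF hY h hn (zero_mem_verticalStrip a), ← integral_complex_ofReal]
  simp

theorem iteratedDerivWithin_cexp_sub_mul_zero (hY : AEMeasurable Y P)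
    (h : Integrable (fun ω ↦ polyExpWeight N a (Y ω)) P)
    (hk : ∀ z ∈ verticalStrip a, Complex.exp (k z) = complexMGF Y P z) (m : ℝ) (hn : n ≤ N) :
    iteratedDerivWithin n (fun z ↦ Complex.exp (k z - m * z)) (verticalStrip a) 0 =
      ((∫ ω, (Y ω - m) ^ n ∂P : ℝ) : ℂ) := by
  rw [← iteratedDerivWithin_complexMGF_zero (hY.sub_const m)
    (integrable_polyExpWeight_sub_const hY h m) hn]
  refine iteratedDerivWithin_congr (fun z hz ↦ ?_) (zero_mem_verticalStrip a)
  rw [sub_eq_add_neg, Complex.exp_add, hk z hz, complexMGF, complexMGF, ← integral_mul_const]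
  congr with ω
  rw [← Complex.exp_add]
  push_cast
  ring_nf

theorem iteratedDerivWithin_sub_mul {f : ℂ → ℂ} {s : Set ℂ} (hs : UniqueDiffOn ℂ s) {z : ℂ}
    (hz : z ∈ s) (hf : ContDiffOn ℂ n f s) (m : ℂ) (hn : n ≠ 0) :
    iteratedDerivWithin n (fun w ↦ f w - m * w) s z =
      iteratedDerivWithin n f s z - if n = 1 then m else 0 := by
  have h_sub := iteratedDerivWithin_sub hz hs (hf z hz)
    ((contDiffOn_const (c := m)).mul contDiffOn_id z hz)
  rw [iteratedDerivWithin_const_mul_field, iteratedDerivWithin_id hz hs, if_neg hn] at h_sub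
  rw [mul_ite, mul_one, mul_zero] at h_sub
  exact h_sub

theorem iteratedDerivWithin_one_zero_of_cexp_eq_complexMGF (hY : AEMeasurable Y P)
    (h : Integrable (fun ω ↦ polyExpWeight N a (Y ω)) P) (hN : 1 ≤ N)
    (hk : ∀ z ∈ verticalStrip a, Complex.exp (k z) = complexMGF Y P z)
    (hk' : ContDiffOn ℂ 1 k (verticalStrip a)) (hk0 : k 0 = 0) :
    iteratedDerivWithin 1 k (verticalStrip a) 0 = ((∫ ω, Y ω ∂P : ℝ) : ℂ) := by
  have h_rec := iteratedDerivWithin_succ_cexp (uniqueDiffOn_verticalStrip a) (n := 0)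
    (by simpa using hk') (zero_mem_verticalStrip a)
  rw [iteratedDerivWithin_congr hk (zero_mem_verticalStrip a),
    iteratedDerivWithin_complexMGF_zero hY h hN] at h_rec
  simpa [hk0] using h_rec.symm

theorem iteratedDerivWithin_zero_of_cexp_eq_complexMGF [IsProbabilityMeasure P]
    (hY : AEMeasurable Y P) (h : Integrable (fun ω ↦ polyExpWeight 4 a (Y ω)) P)
    (hk : ∀ z ∈ verticalStrip a, Complex.exp (k z) = complexMGF Y P z)
    (hk' : ContDiffOn ℂ 4 k (verticalStrip a)) (hk0 : k 0 = 0) :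
    iteratedDerivWithin 2 k (verticalStrip a) 0 = (variance Y P : ℝ) ∧
    iteratedDerivWithin 3 k (verticalStrip a) 0 =
      ((∫ ω, (Y ω - ∫ ω', Y ω' ∂P) ^ 3 ∂P : ℝ) : ℂ) ∧
    iteratedDerivWithin 4 k (verticalStrip a) 0 =
      ((∫ ω, (Y ω - ∫ ω', Y ω' ∂P) ^ 4 ∂P - 3 * variance Y P ^ 2 : ℝ) : ℂ) := by
  set m := ∫ ω', Y ω' ∂P with hm
  have hs := uniqueDiffOn_verticalStrip a
  have h0 := zero_mem_verticalStrip a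
  have h_smooth {n : ℕ} (hn : n ≤ 4) : ContDiffOn ℂ n k (verticalStrip a) :=
    hk'.of_le (by exact_mod_cast hn)
  have h_centred {n : ℕ} (hn : n ≤ 4) (hn₀ : n ≠ 0) :=
    iteratedDerivWithin_sub_mul hs h0 (h_smooth hn) m hn₀
  have h_one : iteratedDerivWithin 1 (fun z ↦ k z - m * z) (verticalStrip a) 0 = 0 := by
    rw [h_centred (by simp) one_ne_zero, iteratedDerivWithin_one_zero_of_cexp_eq_complexMGF hY h
      (by simp) hk (h_smooth (n := 1) (by simp)) hk0, if_pos rfl, ← hm, sub_self]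
  have h_moments := iteratedDerivWithin_of_iteratedDerivWithin_one_eq_zero
    (f := fun z ↦ k z - m * z) hs
    (hk'.sub (contDiffOn_const.mul contDiffOn_id)) h0 (by simp [hk0]) h_one
  have h_moment {n : ℕ} (hn : n ≤ 4) := iteratedDerivWithin_cexp_sub_mul_zero hY h hk m hn
  rw [h_moment (n := 2) (by simp), h_moment (n := 3) (by simp), h_moment (n := 4) (by simp),
    h_centred (n := 2) (by simp) (by simp), h_centred (n := 3) (by simp) (by simp),
    h_centred (n := 4) (by simp) (by simp)] at h_moments
  rw [variance_eq_integral hY]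
  simpa [← hm] using h_moments

end CumulantsAtZero

theorem continuousOn_comp_smul {F : Type*} [TopologicalSpace F] {s : Set ℂ} (hs : Convex ℝ s)
    (h0 : 0 ∈ s) {g : ℂ → F} (hg : ContinuousOn g s) :
    ContinuousOn (fun p : ℝ × ℂ ↦ g (p.1 • p.2)) (Icc 0 1 ×ˢ s) :=
  hg.comp (by fun_prop) fun _ hp ↦ hs.smul_mem_of_zero_mem h0 hp.2 hp.1

section Segments

variable {E : Type*} [NormedAddCommGroup E] [NormedSpace ℂ E] {s : Set ℂ} {D : ℕ → ℂ → E} {N : ℕ}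
  {z : ℂ}

theorem hasDerivWithinAt_comp_smul (hs : Convex ℝ s) (h0 : 0 ∈ s) (hz : z ∈ s) {F : ℂ → E} {F' : E}
    {l : ℝ} (hF : HasDerivWithinAt F F' s (l • z)) :
    HasDerivWithinAt (fun l : ℝ ↦ F (l • z)) (z • F') (Icc 0 1) l := by
  refine hF.scomp l ?_ fun r hr ↦ hs.smul_mem_of_zero_mem h0 hz hr
  simpa using ((hasDerivAt_id l).smul_const z).hasDerivWithinAt

theorem hasDerivWithinAt_pow_smul_comp_smul (hs : Convex ℝ s) (h0 : 0 ∈ s)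
    (hD : ∀ n < N, ∀ w ∈ s, HasDerivWithinAt (D n) (D (n + 1) w) s w) (hz : z ∈ s) {n : ℕ}
    (hn : n < N) {l : ℝ} (hl : l ∈ Icc 0 1) :
    HasDerivWithinAt (fun l : ℝ ↦ z ^ n • D n (l • z)) (z ^ (n + 1) • D (n + 1) (l • z))
      (Icc 0 1) l := by
  rw [pow_succ, mul_smul]
  exact (hasDerivWithinAt_comp_smul hs h0 hz
    (hD n hn _ (hs.smul_mem_of_zero_mem h0 hz hl))).const_smul (z ^ n)

theorem iteratedDerivWithin_comp_smul (hs : Convex ℝ s) (h0 : 0 ∈ s)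
    (hD : ∀ n < N, ∀ w ∈ s, HasDerivWithinAt (D n) (D (n + 1) w) s w) (hz : z ∈ s) {n : ℕ}
    (hn : n ≤ N) {l : ℝ} (hl : l ∈ Icc 0 1) :
    iteratedDerivWithin n (fun l : ℝ ↦ D 0 (l • z)) (Icc 0 1) l = z ^ n • D n (l • z) := by
  simpa using iteratedDerivWithin_eq_of_hasDerivWithinAt (uniqueDiffOn_Icc zero_lt_one)
    (D := fun n (l : ℝ) ↦ z ^ n • D n (l • z))
    (fun n hn l hl ↦ hasDerivWithinAt_pow_smul_comp_smul hs h0 hD hz hn hl) hn hl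

theorem contDiffOn_comp_smul (hs : Convex ℝ s) (h0 : 0 ∈ s)
    (hD : ∀ n < N, ∀ w ∈ s, HasDerivWithinAt (D n) (D (n + 1) w) s w) (hN : ContinuousOn (D N) s)
    (hz : z ∈ s) : ContDiffOn ℝ N (fun l : ℝ ↦ D 0 (l • z)) (Icc 0 1) := by
  simpa using contDiffOn_of_hasDerivWithinAt (uniqueDiffOn_Icc zero_lt_one)
    (D := fun n (l : ℝ) ↦ z ^ n • D n (l • z))
    (fun n hn l hl ↦ hasDerivWithinAt_pow_smul_comp_smul hs h0 hD hz hn hl)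
    (((continuousOn_comp_smul hs h0 hN).comp (f := fun l : ℝ ↦ (l, z)) (by fun_prop)
      fun l hl ↦ ⟨hl, hz⟩).const_smul (z ^ N))

end Segments

section TaylorQuotient

variable {E : Type*} [NormedAddCommGroup E] [NormedSpace ℂ E] {f : ℂ → E} {s : Set ℂ} {n N : ℕ}
  {w : ℂ} {C : ℝ}

theorem hasDerivWithinAt_iteratedDerivWithin (hs : UniqueDiffOn ℂ s) (hf : ContDiffOn ℂ N f s)
    (hn : n < N) (hw : w ∈ s) :
    HasDerivWithinAt (iteratedDerivWithin n f s) (iteratedDerivWithin (n + 1) f s w) s w := by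
  rw [iteratedDerivWithin_succ]
  exact (hf.differentiableOn_iteratedDerivWithin (by exact_mod_cast hn) hs w hw).hasDerivWithinAt

/-- `∫₀¹ (1 - t) tⁿ f⁽ⁿ⁺²⁾(t w) dt`, with the derivatives of `f` taken within `s`. For `n = 0` this
is the remainder quotient `(f w - f 0 - w f' 0) / w²`, continued to `w = 0`; for larger `n` it is
the `n`-th derivative of that quotient. -/
noncomputable def taylorQuotient (f : ℂ → E) (s : Set ℂ) (n : ℕ) (w : ℂ) : E :=
  ∫ t in (0 : ℝ)..1, ((1 - t) * t ^ n) • iteratedDerivWithin (n + 2) f s (t • w)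

theorem norm_one_sub_mul_pow_smul_le {t : ℝ} (ht : t ∈ Icc (0 : ℝ) 1) (n : ℕ) (x : E) :
    ‖((1 - t) * t ^ n) • x‖ ≤ ‖x‖ := by
  have h_nonneg : 0 ≤ (1 - t) * t ^ n := mul_nonneg (sub_nonneg.2 ht.2) (pow_nonneg ht.1 n)
  rw [norm_smul, Real.norm_of_nonneg h_nonneg]
  exact mul_le_of_le_one_left (norm_nonneg x)
    (mul_le_one₀ (sub_le_self 1 ht.1) (pow_nonneg ht.1 n) (pow_le_one₀ ht.1 ht.2))

theorem continuousOn_one_sub_mul_pow_smul (hs : Convex ℝ s) (h0 : 0 ∈ s) {F : ℂ → E}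
    (hF : ContinuousOn F s) (n : ℕ) (hw : w ∈ s) :
    ContinuousOn (fun t : ℝ ↦ ((1 - t) * t ^ n) • F (t • w)) (uIcc 0 1) := by
  rw [uIcc_of_le zero_le_one]
  have h_weight : Continuous fun t : ℝ ↦ (1 - t) * t ^ n := by fun_prop
  exact h_weight.continuousOn.smul ((continuousOn_comp_smul hs h0 hF).comp
    (f := fun t : ℝ ↦ (t, w)) (by fun_prop) fun t ht ↦ ⟨ht, hw⟩)

theorem mem_Icc_of_mem_uIoc_zero_one {t : ℝ} (ht : t ∈ uIoc 0 1) : t ∈ Icc (0 : ℝ) 1 := by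
  rw [uIoc_of_le zero_le_one] at ht
  exact Ioc_subset_Icc_self ht

theorem norm_taylorQuotient_le (hs : Convex ℝ s) (h0 : 0 ∈ s)
    (hC : ∀ w ∈ s, ‖iteratedDerivWithin (n + 2) f s w‖ ≤ C) (hw : w ∈ s) :
    ‖taylorQuotient f s n w‖ ≤ C := by
  have h_le := intervalIntegral.norm_integral_le_of_norm_le_const (a := (0 : ℝ)) (b := 1)
    fun t ht ↦ (norm_one_sub_mul_pow_smul_le (mem_Icc_of_mem_uIoc_zero_one ht) n _).trans
      (hC _ (hs.smul_mem_of_zero_mem h0 hw (mem_Icc_of_mem_uIoc_zero_one ht)))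
  simpa [taylorQuotient] using h_le

theorem continuousOn_taylorQuotient (hs : Convex ℝ s) (h0 : 0 ∈ s)
    (hf : ContinuousOn (iteratedDerivWithin (n + 2) f s) s)
    (hC : ∀ w ∈ s, ‖iteratedDerivWithin (n + 2) f s w‖ ≤ C) :
    ContinuousOn (taylorQuotient f s n) s := fun w hw ↦ by
  have h_mem {w : ℂ} (hw : w ∈ s) {t : ℝ} (ht : t ∈ uIoc 0 1) : t • w ∈ s :=
    hs.smul_mem_of_zero_mem h0 hw (mem_Icc_of_mem_uIoc_zero_one ht)
  refine intervalIntegral.continuousWithinAt_of_dominated_interval (bound := fun _ ↦ C) ?_ ?_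
    intervalIntegrable_const (ae_of_all _ fun t ht ↦ ?_)
  · filter_upwards [self_mem_nhdsWithin] with v hv
    exact ((continuousOn_one_sub_mul_pow_smul hs h0 hf n hv).mono
      uIoc_subset_uIcc).aestronglyMeasurable measurableSet_uIoc
  · filter_upwards [self_mem_nhdsWithin] with v hv
    exact ae_of_all _ fun t ht ↦ (norm_one_sub_mul_pow_smul_le
      (mem_Icc_of_mem_uIoc_zero_one ht) n _).trans (hC _ (h_mem hv ht))
  · exact ((hf.comp (by fun_prop) fun v hv ↦ h_mem hv ht).const_smul ((1 - t) * t ^ n)) w hw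

theorem hasDerivWithinAt_taylorQuotient (hs : Convex ℝ s) (h0 : 0 ∈ s) (hs' : UniqueDiffOn ℂ s)
    (hf : ContDiffOn ℂ (n + 3 : ℕ) f s)
    (hC : ∀ w ∈ s, ‖iteratedDerivWithin (n + 3) f s w‖ ≤ C) (hw : w ∈ s) :
    HasDerivWithinAt (taylorQuotient f s n) (taylorQuotient f s (n + 1) w) s w := by
  have h_mem {w : ℂ} (hw : w ∈ s) {t : ℝ} (ht : t ∈ Icc 0 1) : t • w ∈ s :=
    hs.smul_mem_of_zero_mem h0 hw ht
  have h_cont : ContinuousOn (iteratedDerivWithin (n + 2) f s) s :=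
    hf.continuousOn_iteratedDerivWithin (by norm_cast; omega) hs'
  have h_ae : ∀ᵐ t ∂volume.restrict (Ioc (0 : ℝ) 1), t ∈ Icc (0 : ℝ) 1 :=
    (ae_restrict_mem measurableSet_Ioc).mono fun t ht ↦ Ioc_subset_Icc_self ht
  simp only [funext fun w ↦ taylorQuotient.eq_1 f s n w, taylorQuotient.eq_1 f s (n + 1),
    intervalIntegral.integral_of_le zero_le_one]
  refine hasDerivWithinAt_integral_of_dominated_of_convex hs (bound := fun _ ↦ C)
    (F' := fun w t ↦ ((1 - t) * t ^ (n + 1)) • iteratedDerivWithin (n + 3) f s (t • w))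
    (fun v hv ↦ ?_) (integrable_const C) (h_ae.mono fun t ht v hv ↦ ?_)
    (h_ae.mono fun t ht v hv ↦ (norm_one_sub_mul_pow_smul_le ht _ _).trans (hC _ (h_mem hv ht))) hw
  · exact (continuousOn_one_sub_mul_pow_smul hs h0 h_cont n hv).intervalIntegrable.1
  · have h_smul : HasDerivWithinAt (fun v : ℂ ↦ t • v) (t : ℂ) s v := by
      simpa using ((hasDerivAt_id v).const_mul (t : ℂ)).hasDerivWithinAt
    have h_deriv :=
      hasDerivWithinAt_iteratedDerivWithin (n := n + 2) hs' hf (by omega) (h_mem hv ht)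
    refine ((h_deriv.scomp v h_smul fun v hv ↦ h_mem hv ht).const_smul
      ((1 - t) * t ^ n)).congr_deriv ?_
    rw [Complex.coe_smul, smul_smul, mul_assoc, ← pow_succ]

theorem integral_one_sub_mul_pow (n : ℕ) :
    ∫ t in (0 : ℝ)..1, (1 - t) * t ^ n = 1 / ((n + 1) * (n + 2)) := by
  have h_sub (t : ℝ) : (1 - t) * t ^ n = t ^ n - t ^ (n + 1) := by ring
  simp only [h_sub]
  rw [intervalIntegral.integral_sub (by simp) (by simp), integral_pow, integral_pow]
  simp
  field_simp
  ring

theorem taylorQuotient_zero [CompleteSpace E] (f : ℂ → E) (s : Set ℂ) (n : ℕ) :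
    taylorQuotient f s n 0 =
      ((1 : ℝ) / ((n + 1) * (n + 2))) • iteratedDerivWithin (n + 2) f s 0 := by
  simp only [taylorQuotient, smul_zero]
  rw [intervalIntegral.integral_smul_const, integral_one_sub_mul_pow]

theorem eq_add_smul_taylorQuotient [CompleteSpace E] (hs : Convex ℝ s) (h0 : 0 ∈ s)
    (hs' : UniqueDiffOn ℂ s) (hf : ContDiffOn ℂ 2 f s) (hw : w ∈ s) :
    f w = f 0 + w • iteratedDerivWithin 1 f s 0 + w ^ 2 • taylorQuotient f s 0 w := by
  have h_deriv : ∀ n < 2, ∀ v ∈ s, HasDerivWithinAt (iteratedDerivWithin n f s)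
      (iteratedDerivWithin (n + 1) f s v) s v := fun n hn v hv ↦
    hasDerivWithinAt_iteratedDerivWithin hs' hf hn hv
  have h_iter {n : ℕ} (hn : n ≤ 2) {t : ℝ} (ht : t ∈ uIcc 0 1) :
      iteratedDerivWithin n (fun t : ℝ ↦ f (t • w)) (uIcc 0 1) t =
        w ^ n • iteratedDerivWithin n f s (t • w) := by
    rw [uIcc_of_le zero_le_one] at ht ⊢
    simpa using iteratedDerivWithin_comp_smul hs h0 h_deriv hw hn ht
  have h_smooth : ContDiffOn ℝ (1 + 1 : ℕ) (fun t : ℝ ↦ f (t • w)) (uIcc 0 1) := by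
    rw [uIcc_of_le zero_le_one]
    simpa using contDiffOn_comp_smul hs h0 h_deriv
      (hf.continuousOn_iteratedDerivWithin le_rfl hs') hw
  have h_integral : ∫ t in (0 : ℝ)..1, ((1 - t) ^ 1 / (Nat.factorial 1)) •
      iteratedDerivWithin (1 + 1) (fun t : ℝ ↦ f (t • w)) (uIcc 0 1) t =
        w ^ 2 • taylorQuotient f s 0 w := by
    rw [taylorQuotient, ← intervalIntegral.integral_smul]
    refine intervalIntegral.integral_congr fun t ht ↦ ?_
    simp only [Nat.reduceAdd, h_iter le_rfl ht, smul_comm (w ^ 2)]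
    simp
  have h_taylor := taylor_integral_remainder h_smooth
  rw [h_integral, taylorWithinEval_succ, taylor_within_zero_eval,
    h_iter (by simp) left_mem_uIcc] at h_taylor
  rw [← h_taylor]
  simp

end TaylorQuotient

namespace IsCumulantGenFun

variable {Ω : Type*} [MeasurableSpace Ω] {P : Measure Ω} {Y : ℝ≥0 → Ω → ℝ} {κ : ℂ → ℂ}

theorem cumulantGenFun (hκ : IsCumulantGenFun Y P κ) :
    IsCumulantGenFun Y P (cumulantGenFun Y P) := by
  have h_ex : ∃ κ, IsCumulantGenFun Y P κ := ⟨κ, hκ⟩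
  rw [_root_.cumulantGenFun, dif_pos h_ex]
  exact h_ex.choose_spec

theorem map_zero [IsProbabilityMeasure P] (hκ : IsCumulantGenFun Y P κ) : κ 0 = 0 :=
  eq_of_forall_cexp_mul_eq fun t ↦ by
    rw [← hκ.2 t 0 (by simp [expDomain])]
    simp

end IsCumulantGenFun

section DriftedProcess

variable {Ω Ω' : Type*} [MeasurableSpace Ω] [MeasurableSpace Ω'] {P : Measure Ω} {P' : Measure Ω'}
  {W : ℝ≥0 → Ω' → ℝ}

theorem expDomain_driftedProcess (hW : IsBrownianReal W P') (μ σ : ℝ) :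
    expDomain (driftedProcess μ σ W) P' = univ := by
  refine eq_univ_of_forall fun z ↦ ?_
  have h_law := hW.hasLaw_eval 1
  have h_int : Integrable (fun ω ↦ Real.exp (z.re * σ * W 1 ω)) P' := by
    have h_gauss := integrable_exp_mul_gaussianReal (μ := 0) (v := 1) (z.re * σ)
    rw [← h_law.map_eq] at h_gauss
    exact h_gauss.comp_aemeasurable h_law.aemeasurable
  refine (h_int.const_mul (Real.exp (z.re * μ))).congr (ae_of_all _ fun ω ↦ ?_)
  simp only [driftedProcess, NNReal.coe_one, mul_one]
  rw [← Real.exp_add]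
  ring_nf

theorem isCumulantGenFun_driftedProcess (hW : IsBrownianReal W P') (μ σ : ℝ) :
    IsCumulantGenFun (driftedProcess μ σ W) P' (fun z ↦ μ * z + 1 / 2 * σ ^ 2 * z ^ 2) := by
  refine ⟨by fun_prop, fun t z _ ↦ ?_⟩
  have h_split (ω : Ω') : Complex.exp (z * driftedProcess μ σ W t ω) =
      Complex.exp (t * (μ * z)) * Complex.exp (z * σ * W t ω) := by
    rw [← Complex.exp_add, driftedProcess]
    push_cast
    ring_nf
  have h_gauss := complexMGF_gaussianReal (hW.hasLaw_eval t).map_eq (z * σ)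
  rw [complexMGF] at h_gauss
  simp only [h_split]
  rw [integral_const_mul, h_gauss, ← Complex.exp_add]
  push_cast
  ring_nf

theorem isCumulantGenFun_kappaFamily_zero (X : ℝ≥0 → Ω → ℝ) (hW : IsBrownianReal W P') :
    IsCumulantGenFun (driftedProcess (∫ ω, X 1 ω ∂P) √(variance (X 1) P) W) P'
      (kappaFamily X P W P' 0) := by
  rw [kappaFamily, if_pos rfl]
  exact (isCumulantGenFun_driftedProcess hW _ _).cumulantGenFun

theorem kappaFamily_zero_apply (X : ℝ≥0 → Ω → ℝ) (hW : IsBrownianReal W P') (z : ℂ) :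
    kappaFamily X P W P' 0 z =
      (∫ ω, X 1 ω ∂P : ℝ) * z + 1 / 2 * (√(variance (X 1) P) : ℂ) ^ 2 * z ^ 2 :=
  (isCumulantGenFun_kappaFamily_zero X hW).eqOn (isCumulantGenFun_driftedProcess hW _ _)
    (by simp [expDomain_driftedProcess hW])

end DriftedProcess

namespace IsLevyProcess

variable {Ω Ω' : Type*} [MeasurableSpace Ω] [MeasurableSpace Ω'] {P : Measure Ω} {P' : Measure Ω'}
  [IsProbabilityMeasure P] {X : ℝ≥0 → Ω → ℝ} {W : ℝ≥0 → Ω' → ℝ} {κ : ℂ → ℂ} {a l : ℝ} {z : ℂ}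

theorem mem_expDomain_scaledProcess_iff (hX : IsLevyProcess X P) (hl : l ∈ Ioc 0 1) :
    z ∈ expDomain (scaledProcess X P l) P ↔ l * z ∈ expDomain X P := by
  have h_time : 1 ≤ 1 / l.toNNReal ^ 2 :=
    one_le_one_div (pow_pos (Real.toNNReal_pos.2 hl.1) 2)
      (pow_le_one₀ zero_le (Real.toNNReal_le_one.2 hl.2))
  have h_split (ω : Ω) : Real.exp (z.re * scaledProcess X P l 1 ω) =
      Real.exp (z.re * ((1 - 1 / l) * ∫ ω', X 1 ω' ∂P)) *
        Real.exp (l * z.re * X (1 / l.toNNReal ^ 2) ω) := by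
    rw [← Real.exp_add, scaledProcess, NNReal.coe_one]
    ring_nf
  rw [expDomain_eq_preimage X, mem_preimage, Complex.re_ofReal_mul,
    ← hX.integrableExpSet_eq h_time, expDomain, mem_ofPred_eq]
  simp only [h_split]
  exact integrable_const_mul_iff (Real.exp_pos _).ne'.isUnit _

theorem isCumulantGenFun_scaledProcess (hX : IsLevyProcess X P) (hκ : IsCumulantGenFun X P κ)
    (hl : l ∈ Ioc 0 1) :
    IsCumulantGenFun (scaledProcess X P l) P
      (fun z ↦ (1 - 1 / l) * (∫ ω, X 1 ω ∂P : ℝ) * z + κ (l * z) / l ^ 2) := by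
  have h_mem {z : ℂ} := hX.mem_expDomain_scaledProcess_iff (z := z) hl
  refine ⟨ContinuousOn.add (by fun_prop) (ContinuousOn.div_const
    (hκ.1.comp (by fun_prop) fun z hz ↦ h_mem.1 hz) _), fun t z hz ↦ ?_⟩
  have h_split (ω : Ω) : Complex.exp (z * scaledProcess X P l t ω) =
      Complex.exp (t * ((1 - 1 / l) * (∫ ω, X 1 ω ∂P : ℝ) * z)) *
        Complex.exp (l * z * X (t / l.toNNReal ^ 2) ω) := by
    rw [← Complex.exp_add, scaledProcess]
    push_cast
    ring_nf
  have h_time : ((t / l.toNNReal ^ 2 : ℝ≥0) : ℂ) = t / l ^ 2 := by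
    rw [← Complex.ofReal_pow, ← Complex.ofReal_div]
    push_cast
    rw [Real.coe_toNNReal l hl.1.le]
  simp only [h_split]
  rw [integral_const_mul, hκ.2 _ _ (h_mem.1 hz), ← Complex.exp_add, h_time]
  ring_nf

theorem isCumulantGenFun_kappaFamily (hX : IsLevyProcess X P) (W : ℝ≥0 → Ω' → ℝ) (P' : Measure Ω')
    (hl : l ∈ Ioc 0 1) : IsCumulantGenFun (scaledProcess X P l) P (kappaFamily X P W P' l) := by
  obtain ⟨κ, hκ⟩ := hX.exists_isCumulantGenFun
  rw [kappaFamily, if_neg hl.1.ne']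
  exact (hX.isCumulantGenFun_scaledProcess hκ hl).cumulantGenFun

theorem kappaFamily_apply (hX : IsLevyProcess X P) (hκ : IsCumulantGenFun X P κ)
    (W : ℝ≥0 → Ω' → ℝ) (P' : Measure Ω') (hl : l ∈ Ioc 0 1) (hz : l * z ∈ expDomain X P) :
    kappaFamily X P W P' l z = (1 - 1 / l) * (∫ ω, X 1 ω ∂P : ℝ) * z + κ (l * z) / l ^ 2 :=
  (hX.isCumulantGenFun_kappaFamily W P' hl).eqOn (hX.isCumulantGenFun_scaledProcess hκ hl)
    ((hX.mem_expDomain_scaledProcess_iff hl).2 hz)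

end IsLevyProcess

section ScaledFunctions

variable {s : Set ℂ} {D : ℕ → ℂ → ℂ} {n N : ℕ} {z : ℂ} {l : ℝ}

theorem iteratedDerivWithin_add_mul_comp_smul (hs : Convex ℝ s) (h0 : 0 ∈ s)
    (hD : ∀ n < N, ∀ w ∈ s, HasDerivWithinAt (D n) (D (n + 1) w) s w) (hz : z ∈ s) (hn : n ≤ N)
    (hl : l ∈ Icc 0 1) (c b : ℂ) :
    iteratedDerivWithin n (fun l : ℝ ↦ c + b * D 0 (l • z)) (Icc 0 1) l =
      (if n = 0 then c else 0) + b * (z ^ n * D n (l • z)) := by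
  rcases n.eq_zero_or_pos with rfl | hpos
  · simp
  · rw [iteratedDerivWithin_const_add hpos, iteratedDerivWithin_const_mul_field,
      iteratedDerivWithin_comp_smul hs h0 hD hz hn hl, if_neg hpos.ne', zero_add, smul_eq_mul]

theorem continuousOn_add_mul_comp_smul (hs : Convex ℝ s) (h0 : 0 ∈ s) (hD : ContinuousOn (D n) s)
    (m : ℂ) :
    ContinuousOn (fun p : ℝ × ℂ ↦
      (if n = 0 then m * p.2 else 0) + p.2 ^ 2 * (p.2 ^ n * D n (p.1 • p.2))) (Icc 0 1 ×ˢ s) := by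
  refine ContinuousOn.add (by split_ifs <;> fun_prop) (ContinuousOn.mul (by fun_prop)
    (ContinuousOn.mul (by fun_prop) (continuousOn_comp_smul hs h0 hD)))

theorem norm_add_mul_comp_smul_le {C : ℝ} (hs : Convex ℝ s) (h0 : 0 ∈ s)
    (hD : ∀ w ∈ s, ‖D n w‖ ≤ C) (hz : z ∈ s) (hl : l ∈ Icc 0 1) (m : ℂ) :
    ‖(if n = 0 then m * z else 0) + z ^ 2 * (z ^ n * D n (l • z))‖ ≤
      (‖m‖ + C) * (1 + ‖z‖ ^ (3 + n)) := by
  have h_pow {j : ℕ} (hj : j ≤ 3 + n) : ‖z‖ ^ j ≤ 1 + ‖z‖ ^ (3 + n) := by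
    simpa using pow_le_pow_add_pow_of_mem_Icc (m := 0) ⟨j.zero_le, hj⟩ (norm_nonneg z)
  have hC := hD _ (hs.smul_mem_of_zero_mem h0 hz hl)
  have h_fst : ‖if n = 0 then m * z else 0‖ ≤ ‖m‖ * (1 + ‖z‖ ^ (3 + n)) := by
    split_ifs
    · simpa using mul_le_mul_of_nonneg_left (h_pow (j := 1) (by omega)) (norm_nonneg m)
    · simpa using by positivity
  have h_snd : ‖z ^ 2 * (z ^ n * D n (l • z))‖ ≤ C * (1 + ‖z‖ ^ (3 + n)) := by
    rw [← mul_assoc, ← pow_add, norm_mul, norm_pow, mul_comm]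
    exact mul_le_mul hC (h_pow (by omega)) (by positivity) ((norm_nonneg _).trans hC)
  rw [add_mul]
  exact (norm_add_le _ _).trans (add_le_add h_fst h_snd)

end ScaledFunctions

section KappaFamily

variable {Ω Ω' : Type*} [MeasurableSpace Ω] [MeasurableSpace Ω'] {P : Measure Ω} {P' : Measure Ω'}
  [IsProbabilityMeasure P] {X : ℝ≥0 → Ω → ℝ} {W : ℝ≥0 → Ω' → ℝ} {κ : ℂ → ℂ} {a l : ℝ} {z : ℂ}
  {n : ℕ}

theorem IsCumulantGenFun.iteratedDerivWithin_one_zero (hκ : IsCumulantGenFun X P κ)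
    (hX : AEMeasurable (X 1) P) (h : Integrable (fun ω ↦ polyExpWeight 4 a (X 1 ω)) P) :
    iteratedDerivWithin 1 κ (verticalStrip a) 0 = (∫ ω, X 1 ω ∂P : ℝ) :=
  iteratedDerivWithin_one_zero_of_cexp_eq_complexMGF hX h (by simp)
    (fun _ hz ↦ hκ.cexp_eq_complexMGF (verticalStrip_subset_expDomain hX h hz))
    ((hκ.contDiffOn hX h).of_le (by norm_num)) hκ.map_zero

theorem IsCumulantGenFun.taylorQuotient_zero (hκ : IsCumulantGenFun X P κ)
    (hX : AEMeasurable (X 1) P) (h : Integrable (fun ω ↦ polyExpWeight 4 a (X 1 ω)) P) :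
    taylorQuotient κ (verticalStrip a) 0 0 = 1 / 2 * (variance (X 1) P : ℝ) ∧
    taylorQuotient κ (verticalStrip a) 1 0 =
      1 / 6 * (∫ ω, (X 1 ω - ∫ ω', X 1 ω' ∂P) ^ 3 ∂P : ℝ) ∧
    taylorQuotient κ (verticalStrip a) 2 0 =
      1 / 12 * (∫ ω, (X 1 ω - ∫ ω', X 1 ω' ∂P) ^ 4 ∂P - 3 * variance (X 1) P ^ 2 : ℝ) := by
  obtain ⟨h_two, h_three, h_four⟩ := iteratedDerivWithin_zero_of_cexp_eq_complexMGF hX h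
    (fun _ hz ↦ hκ.cexp_eq_complexMGF (verticalStrip_subset_expDomain hX h hz))
    (hκ.contDiffOn hX h) hκ.map_zero
  rw [_root_.taylorQuotient_zero, _root_.taylorQuotient_zero, _root_.taylorQuotient_zero,
    h_two, h_three, h_four]
  norm_num [Complex.real_smul]

theorem IsLevyProcess.kappaFamily_eq_add_sq_mul_taylorQuotient (hX : IsLevyProcess X P)
    (hκ : IsCumulantGenFun X P κ) (h : Integrable (fun ω ↦ polyExpWeight 4 a (X 1 ω)) P)
    (hW : IsBrownianReal W P') (hz : z ∈ verticalStrip a) (hl : l ∈ Icc 0 1) :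
    kappaFamily X P W P' l z =
      (∫ ω, X 1 ω ∂P : ℝ) * z + z ^ 2 * taylorQuotient κ (verticalStrip a) 0 (l • z) := by
  have hX' := (hX.measurable 1).aemeasurable (μ := P)
  have hlz := (convex_verticalStrip a).smul_mem_of_zero_mem (zero_mem_verticalStrip a) hz hl
  rcases hl.1.eq_or_lt with rfl | hpos
  · rw [kappaFamily_zero_apply X hW, zero_smul, (hκ.taylorQuotient_zero hX' h).1,
      ← Complex.ofReal_pow, Real.sq_sqrt (variance_nonneg _ _)]
    ring
  · have h_taylor := eq_add_smul_taylorQuotient (convex_verticalStrip a) (zero_mem_verticalStrip a)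
      (uniqueDiffOn_verticalStrip a) ((hκ.contDiffOn hX' h).of_le (by norm_num)) hlz
    have h_ne : (l : ℂ) ≠ 0 := by exact_mod_cast hpos.ne'
    rw [hκ.map_zero, hκ.iteratedDerivWithin_one_zero hX' h] at h_taylor
    simp only [Complex.real_smul, smul_eq_mul] at h_taylor hlz ⊢
    rw [hX.kappaFamily_apply hκ W P' ⟨hpos, hl.2⟩ (verticalStrip_subset_expDomain hX' h hlz),
      h_taylor]
    field_simp
    ring

end KappaFamily

namespace IsLevyProcess

variable {Ω Ω' : Type*} [MeasurableSpace Ω] [MeasurableSpace Ω'] {P : Measure Ω} {P' : Measure Ω'}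
  [IsProbabilityMeasure P] {X : ℝ≥0 → Ω → ℝ} {W : ℝ≥0 → Ω' → ℝ} {κ : ℂ → ℂ} {a l : ℝ} {z : ℂ}
  {n : ℕ}

theorem exists_norm_taylorQuotient_le (hX : IsLevyProcess X P) (hκ : IsCumulantGenFun X P κ)
    (h : Integrable (fun ω ↦ polyExpWeight 4 a (X 1 ω)) P) :
    ∃ C, ∀ n ≤ 2, ∀ w ∈ verticalStrip a, ‖taylorQuotient κ (verticalStrip a) n w‖ ≤ C := by
  obtain ⟨C, hC⟩ := hX.exists_norm_iteratedDerivWithin_le hκ h two_ne_zero even_two (by decide)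
  exact ⟨C, fun n hn _ hw ↦ norm_taylorQuotient_le (convex_verticalStrip a)
    (zero_mem_verticalStrip a) (hC (n + 2) ⟨by omega, by omega⟩) hw⟩

theorem continuousOn_taylorQuotient (hX : IsLevyProcess X P) (hκ : IsCumulantGenFun X P κ)
    (h : Integrable (fun ω ↦ polyExpWeight 4 a (X 1 ω)) P) (hn : n ≤ 2) :
    ContinuousOn (taylorQuotient κ (verticalStrip a) n) (verticalStrip a) := by
  obtain ⟨C, hC⟩ := hX.exists_norm_iteratedDerivWithin_le hκ h two_ne_zero even_two (by decide)
  exact _root_.continuousOn_taylorQuotient (convex_verticalStrip a) (zero_mem_verticalStrip a)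
    ((hκ.contDiffOn (hX.measurable 1).aemeasurable h).continuousOn_iteratedDerivWithin
      (by norm_cast; omega) (uniqueDiffOn_verticalStrip a)) (hC (n + 2) ⟨by omega, by omega⟩)

theorem hasDerivWithinAt_taylorQuotient (hX : IsLevyProcess X P) (hκ : IsCumulantGenFun X P κ)
    (h : Integrable (fun ω ↦ polyExpWeight 4 a (X 1 ω)) P) (hn : n < 2)
    (hz : z ∈ verticalStrip a) :
    HasDerivWithinAt (taylorQuotient κ (verticalStrip a) n)
      (taylorQuotient κ (verticalStrip a) (n + 1) z) (verticalStrip a) z := by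
  obtain ⟨C, hC⟩ := hX.exists_norm_iteratedDerivWithin_le hκ h two_ne_zero even_two (by decide)
  exact _root_.hasDerivWithinAt_taylorQuotient (convex_verticalStrip a) (zero_mem_verticalStrip a)
    (uniqueDiffOn_verticalStrip a)
    ((hκ.contDiffOn (hX.measurable 1).aemeasurable h).of_le (by norm_cast; omega))
    (hC (n + 3) ⟨by omega, by omega⟩) hz

theorem contDiffOn_kappaFamily (hX : IsLevyProcess X P) (hW : IsBrownianReal W P')
    (h : Integrable (fun ω ↦ polyExpWeight 4 a (X 1 ω)) P) (hz : z ∈ verticalStrip a) :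
    ContDiffOn ℝ 2 (fun l ↦ kappaFamily X P W P' l z) (Icc 0 1) := by
  obtain ⟨κ, hκ⟩ := hX.exists_isCumulantGenFun
  refine ContDiffOn.congr (contDiffOn_const.add (contDiffOn_const.mul ?_))
    fun l hl ↦ hX.kappaFamily_eq_add_sq_mul_taylorQuotient hκ h hW hz hl
  exact contDiffOn_comp_smul (N := 2) (convex_verticalStrip a) (zero_mem_verticalStrip a)
    (fun n hn w hw ↦ hX.hasDerivWithinAt_taylorQuotient hκ h hn hw)
    (hX.continuousOn_taylorQuotient hκ h le_rfl) hz

theorem iteratedDerivWithin_kappaFamily (hX : IsLevyProcess X P) (hκ : IsCumulantGenFun X P κ)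
    (hW : IsBrownianReal W P') (h : Integrable (fun ω ↦ polyExpWeight 4 a (X 1 ω)) P)
    (hn : n ≤ 2) (hz : z ∈ verticalStrip a) (hl : l ∈ Icc 0 1) :
    iteratedDerivWithin n (fun l ↦ kappaFamily X P W P' l z) (Icc 0 1) l =
      (if n = 0 then (∫ ω, X 1 ω ∂P : ℝ) * z else 0) +
        z ^ 2 * (z ^ n * taylorQuotient κ (verticalStrip a) n (l • z)) := by
  rw [iteratedDerivWithin_congr
    (fun _ hl ↦ hX.kappaFamily_eq_add_sq_mul_taylorQuotient hκ h hW hz hl) hl]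
  exact iteratedDerivWithin_add_mul_comp_smul (D := taylorQuotient κ (verticalStrip a)) (N := 2)
    (convex_verticalStrip a) (zero_mem_verticalStrip a) (fun n hn w hw ↦
      hX.hasDerivWithinAt_taylorQuotient hκ h hn hw) hz hn hl _ _

theorem continuousOn_iteratedDerivWithin_kappaFamily (hX : IsLevyProcess X P)
    (hW : IsBrownianReal W P') (h : Integrable (fun ω ↦ polyExpWeight 4 a (X 1 ω)) P)
    (hn : n ≤ 2) :
    ContinuousOn
      (fun p : ℝ × ℂ ↦ iteratedDerivWithin n (fun l ↦ kappaFamily X P W P' l p.2) (Icc 0 1) p.1)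
      (Icc 0 1 ×ˢ verticalStrip a) := by
  obtain ⟨κ, hκ⟩ := hX.exists_isCumulantGenFun
  exact (continuousOn_add_mul_comp_smul (convex_verticalStrip a) (zero_mem_verticalStrip a)
    (hX.continuousOn_taylorQuotient hκ h hn) _).congr fun p hp ↦
      hX.iteratedDerivWithin_kappaFamily hκ hW h hn hp.2 hp.1

theorem iteratedDerivWithin_kappaFamily_zero (hX : IsLevyProcess X P) (hW : IsBrownianReal W P')
    (h : Integrable (fun ω ↦ polyExpWeight 4 a (X 1 ω)) P) (hz : z ∈ verticalStrip a) :
    iteratedDerivWithin 1 (fun l ↦ kappaFamily X P W P' l z) (Icc 0 1) 0 =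
      1 / 6 * (∫ ω, (X 1 ω - ∫ ω', X 1 ω' ∂P) ^ 3 ∂P : ℝ) * z ^ 3 ∧
    iteratedDerivWithin 2 (fun l ↦ kappaFamily X P W P' l z) (Icc 0 1) 0 =
      1 / 12 * (∫ ω, (X 1 ω - ∫ ω', X 1 ω' ∂P) ^ 4 ∂P - 3 * variance (X 1) P ^ 2 : ℝ) * z ^ 4 := by
  obtain ⟨κ, hκ⟩ := hX.exists_isCumulantGenFun
  obtain ⟨-, h_one, h_two⟩ := hκ.taylorQuotient_zero (hX.measurable 1).aemeasurable h
  have h_iter {n : ℕ} (hn : n ≤ 2) :=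
    hX.iteratedDerivWithin_kappaFamily hκ hW h hn hz (left_mem_Icc.2 zero_le_one)
  rw [h_iter one_le_two, h_iter le_rfl, zero_smul, h_one, h_two]
  constructor <;> norm_num <;> ring

theorem exists_norm_iteratedDerivWithin_kappaFamily_le (hX : IsLevyProcess X P)
    (hW : IsBrownianReal W P') (h : Integrable (fun ω ↦ polyExpWeight 4 a (X 1 ω)) P) :
    ∃ c : ℝ, 0 < c ∧ ∀ n ≤ 2, ∀ l ∈ Icc (0 : ℝ) 1, ∀ z ∈ verticalStrip a,
      ‖iteratedDerivWithin n (fun l' ↦ kappaFamily X P W P' l' z) (Icc 0 1) l‖ ≤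
        c * (1 + ‖z‖ ^ (3 + n)) := by
  obtain ⟨κ, hκ⟩ := hX.exists_isCumulantGenFun
  obtain ⟨C, hC⟩ := hX.exists_norm_taylorQuotient_le hκ h
  refine ⟨max (‖((∫ ω, X 1 ω ∂P : ℝ) : ℂ)‖ + C) 1, by positivity, fun n hn l hl z hz ↦ ?_⟩
  rw [hX.iteratedDerivWithin_kappaFamily hκ hW h hn hz hl]
  refine (norm_add_mul_comp_smul_le (convex_verticalStrip a) (zero_mem_verticalStrip a) (hC n hn)
    hz hl _).trans ?_
  gcongr
  exact le_max_left _ _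

end IsLevyProcess

theorem verticalLines_subset_verticalStrip (R : ℝ) : verticalLines R ⊆ verticalStrip (2 * R) := by
  rintro z (h | h | h)
  · simp [verticalStrip, h]
  · rw [verticalStrip, mem_preimage, h, mem_uIcc]
    exact (le_total 0 R).imp (fun _ ↦ by constructor <;> linarith)
      fun _ ↦ by constructor <;> linarith
  · rw [mem_singleton_iff] at h
    simp [verticalStrip, h]

theorem integrable_pow_abs_mul_exp_of_mem_interior_expDomain {Ω : Type*} [MeasurableSpace Ω]
    {P : Measure Ω} {Y : ℝ≥0 → Ω → ℝ} {a : ℝ} (ha : (a : ℂ) ∈ interior (expDomain Y P)) (n : ℕ) :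
    Integrable (fun ω ↦ |Y 1 ω| ^ n * Real.exp (a * Y 1 ω)) P := by
  rw [expDomain_eq_preimage, Complex.interior_preimage_re] at ha
  exact integrable_pow_abs_mul_exp_of_mem_interior_integrableExpSet ha n

theorem proposition4p9_general {Ω Ω' : Type*} [MeasurableSpace Ω] [MeasurableSpace Ω']
    (P : Measure Ω) [IsProbabilityMeasure P] (P' : Measure Ω')
    (X : ℝ≥0 → Ω → ℝ) (hX : IsLevyProcess X P)
    (W : ℝ≥0 → Ω' → ℝ) (hW : IsBrownianReal W P')
    (a : ℝ) (hmom : Integrable (fun ω ↦ |X 1 ω| ^ 4) P)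
    (hexp : Integrable (fun ω ↦ |X 1 ω| ^ 4 * Real.exp (a * X 1 ω)) P)
    (S : Set ℂ) (hS : S ⊆ verticalStrip a)
    (μ σ : ℝ) (hμ : μ = ∫ ω, X 1 ω ∂P) (hσ : σ = √(variance (X 1) P))
    (κ : ℝ → ℂ → ℂ) (hκ : κ = kappaFamily X P W P') :
    (IsCumulantGenFun (driftedProcess μ σ W) P' (κ 0) ∧
      S ⊆ expDomain (driftedProcess μ σ W) P') ∧
    (∀ l ∈ Ioc (0 : ℝ) 1, IsCumulantGenFun (scaledProcess X P l) P (κ l) ∧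
      S ⊆ expDomain (scaledProcess X P l) P) ∧
    (∀ z ∈ S, ContDiffOn ℝ 2 (fun l ↦ κ l z) (Icc 0 1)) ∧
    (∀ n ≤ 2, ContinuousOn
      (fun p : ℝ × ℂ ↦ iteratedDerivWithin n (fun l ↦ κ l p.2) (Icc 0 1) p.1)
      (Icc 0 1 ×ˢ S)) ∧
    (∀ z ∈ S,
      κ 0 z = μ * z + 1 / 2 * σ ^ 2 * z ^ 2 ∧
      iteratedDerivWithin 1 (fun l ↦ κ l z) (Icc 0 1) 0 =
        1 / 6 * ((∫ ω, (X 1 ω - μ) ^ 3 ∂P : ℝ) : ℂ) * z ^ 3 ∧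
      iteratedDerivWithin 2 (fun l ↦ κ l z) (Icc 0 1) 0 =
        1 / 12 * (((∫ ω, (X 1 ω - μ) ^ 4 ∂P) - 3 * σ ^ 4 : ℝ) : ℂ) * z ^ 4) ∧
    (∃ c₁ : ℝ, 0 < c₁ ∧ ∀ n ≤ 2, ∀ l ∈ Icc (0 : ℝ) 1, ∀ z ∈ S,
      ‖iteratedDerivWithin n (fun l' ↦ κ l' z) (Icc 0 1) l‖ ≤ c₁ * (1 + ‖z‖ ^ (3 + n))) := by
  have hX' := (hX.measurable 1).aemeasurable (μ := P)
  have h := integrable_polyExpWeight_comp hX' hmom hexp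
  have h_sq : σ ^ 4 = variance (X 1) P ^ 2 := by
    rw [hσ, pow_mul _ 2 2, Real.sq_sqrt (variance_nonneg _ _)]
  rw [h_sq]
  subst hμ hσ hκ
  obtain ⟨c, hc, h_growth⟩ := hX.exists_norm_iteratedDerivWithin_kappaFamily_le hW h
  refine ⟨⟨isCumulantGenFun_kappaFamily_zero X hW, ?_⟩,
    fun l hl ↦ ⟨hX.isCumulantGenFun_kappaFamily W P' hl, fun z hz ↦ ?_⟩,
    fun z hz ↦ hX.contDiffOn_kappaFamily hW h (hS hz),
    fun n hn ↦ (hX.continuousOn_iteratedDerivWithin_kappaFamily hW h hn).mono (prod_mono_right hS),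
    fun z hz ↦ ⟨kappaFamily_zero_apply X hW z,
      hX.iteratedDerivWithin_kappaFamily_zero hW h (hS hz)⟩,
    c, hc, fun n hn l hl z hz ↦ h_growth n hn l hl z (hS hz)⟩
  · simp [expDomain_driftedProcess hW]
  · have h_mem := (convex_verticalStrip a).smul_mem_of_zero_mem (zero_mem_verticalStrip a) (hS hz)
      (Ioc_subset_Icc_self hl)
    exact (hX.mem_expDomain_scaledProcess_iff hl).2 (verticalStrip_subset_expDomain hX' h h_mem)

theorem proposition4p9 {Ω Ω' : Type*} [MeasurableSpace Ω] [MeasurableSpace Ω']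
    (P : Measure Ω) [IsProbabilityMeasure P] (P' : Measure Ω') [IsProbabilityMeasure P']
    (X : ℝ≥0 → Ω → ℝ) (hX : IsLevyProcess X P)
    (W : ℝ≥0 → Ω' → ℝ) (hW : IsBrownianReal W P')
    (hexp : Integrable (fun ω ↦ Real.exp (2 * X 1 ω)) P)
    (hmom : ∀ n ∈ Finset.Icc 1 5, Integrable (fun ω ↦ |X 1 ω| ^ n) P)
    (hvar : 0 < variance (X 1) P)
    (R : ℝ) (hR : R ≠ 0) (hRD : ((2 * R : ℝ) : ℂ) ∈ interior (expDomain X P))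
    (μ σ : ℝ) (hμ : μ = ∫ ω, X 1 ω ∂P) (hσ : σ = √(variance (X 1) P))
    (κ : ℝ → ℂ → ℂ) (hκ : κ = kappaFamily X P W P') :
    -- the cumulant generating functions exist, and the three lines lie in their domains
    (IsCumulantGenFun (driftedProcess μ σ W) P' (κ 0) ∧
      verticalLines R ⊆ expDomain (driftedProcess μ σ W) P') ∧
    (∀ l ∈ Ioc (0 : ℝ) 1, IsCumulantGenFun (scaledProcess X P l) P (κ l) ∧
      verticalLines R ⊆ expDomain (scaledProcess X P l) P) ∧
    -- twice differentiable in the parameter, with jointly continuous derivatives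
    (∀ z ∈ verticalLines R, ContDiffOn ℝ 2 (fun l ↦ κ l z) (Icc 0 1)) ∧
    (∀ n ≤ 2, ContinuousOn
      (fun p : ℝ × ℂ ↦ iteratedDerivWithin n (fun l ↦ κ l p.2) (Icc 0 1) p.1)
      (Icc 0 1 ×ˢ verticalLines R)) ∧
    -- the values at `l = 0`
    (∀ z ∈ verticalLines R,
      κ 0 z = μ * z + 1 / 2 * σ ^ 2 * z ^ 2 ∧
      iteratedDerivWithin 1 (fun l ↦ κ l z) (Icc 0 1) 0 =
        1 / 6 * ((∫ ω, (X 1 ω - μ) ^ 3 ∂P : ℝ) : ℂ) * z ^ 3 ∧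
      iteratedDerivWithin 2 (fun l ↦ κ l z) (Icc 0 1) 0 =
        1 / 12 * (((∫ ω, (X 1 ω - μ) ^ 4 ∂P) - 3 * σ ^ 4 : ℝ) : ℂ) * z ^ 4) ∧
    -- the growth estimates
    (∃ c₁ : ℝ, 0 < c₁ ∧ ∀ n ≤ 2, ∀ l ∈ Icc (0 : ℝ) 1, ∀ z ∈ verticalLines R,
      ‖iteratedDerivWithin n (fun l' ↦ κ l' z) (Icc 0 1) l‖ ≤ c₁ * (1 + ‖z‖ ^ (3 + n))) := by
  exact proposition4p9_general P P' X hX W hW (2 * R) (hmom 4 (by decide))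
    (integrable_pow_abs_mul_exp_of_mem_interior_expDomain hRD 4) (verticalLines R)
    (verticalLines_subset_verticalStrip R) μ σ hμ hσ κ hκ
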